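/- Let $\Gamma$ be a group with an orientation preserving continuous action on $S^1=\mathbb{R}/\mathbb{Z}$, i.e., a homomorphism $\rho\colon\Gamma\to\mathrm{Homeo}^+(S^1)$. For $g\in\Gamma$ let $\tilde g\colon\mathbb{R}\to\mathbb{R}$ be the lift of $\rho(g)$ with $\tilde g(0)\in[0,1)$, and let $c(g,h)\in\{0,1\}$ be given by $\tilde g\circ\tilde h=\widetilde{gh}+c(g,h)$. The classes of $c$ in $H^2(\Gamma;\mathbb{Z})$ and in bounded cohomology $H^2_b(\Gamma;\mathbb{R})$ are the Euler class $\mathrm{eu}$ and the bounded Euler class $\mathrm{eu}_b$. Assume that $\Gamma$ is finitely presented; that $H_1(\Gamma;\mathbb{Z})$ is finite; that every quasimorphism $\Gamma\to\mathbb{R}$ is trivial, i.e., at bounded distance from a homomorphism; and that $H^2_b(\Gamma;\mathbb{R})$ is one-dimensional and generated by $\mathrm{eu}_b$. Let $\widetilde\Gamma$ be the central extension of $\Gamma$ by $\mathbb{Z}$ with class $\mathrm{eu}$, and let $H:=H_2(\Gamma;\mathbb{Z})$. Then the image of the evaluation map $\langle\mathrm{eu},\cdot\rangle\colon H\to\mathbb{Z}$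 is $m\mathbb{Z}$ for some integer $m>0$. Let $\epsilon:=\frac1m\langle\mathrm{eu},\cdot\rangle\colon H\to\mathbb{Z}$. There exists a class $\varphi\in H^2(\Gamma;H)$ with $H^2(\mathrm{id}_\Gamma;\epsilon)(\varphi)=\mathrm{eu}$ and $\langle\varphi,\cdot\rangle=m\cdot\mathrm{id}_H$. For every such $\varphi$, let $E$ be the central extension of $\Gamma$ by $H$ with class $\varphi$. There exists an epimorphism $\psi\colon E\to\widetilde\Gamma$ with $\psi|_H=\epsilon$ and $\ker\psi\subset H$ that induces the identity on $\Gamma$. Moreover: 1. The group $E$ is finitely presented and $H_2(E;\mathbb{R})\cong 0$. 2. For a group $G$ let $Q(G)$ be the real vector space of quasimorphisms $G\to\mathbb{R}$ modulo trivial quasimorphisms. Every epimorphism $\psi\colon E\to\widetilde\Gamma$ with $\psi|_H=\epsilon$ and $\ker\psi\subset H$ induces an isomorphism $Q(\psi)\colon Q(\widetilde\Gamma)\to Q(E)$, $[f]\mapsto[f\circ\psi]$, and both spaces are one-dimensional. 3. We have $\mathrm{scl}_E([E,E])=\mathrm{scl}_{\widetilde\Gamma}([\widetilde\Gamma,\widetilde\Gamma])$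 as subsets of $\mathbb{R}$, where $\mathrm{scl}_G(g)=\lim_{n\to\infty}\mathrm{cl}_G(g^n)/n$ and $\mathrm{cl}_G$ is the commutator length. -/

import Mathlib

open CategoryTheory

noncomputable section

/-! ### Second group (co)homology with trivial coefficients and the Kronecker pairing -/

section Kronecker

universe u

variable (k G : Type u) [CommRing k] [Group G]

/-- `H_n(G; k)`, for the trivial `G`-action on `k`. -/
abbrev trivialHomology (n : ℕ) : ModuleCat.{u} k := groupHomology (Rep.trivial k G k) n

variable {k}

/-- `H²(G; A)`, for the trivial `G`-action on the `k`-module `A`. -/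
abbrev trivialCohomology₂ (A : ModuleCat.{u} k) : ModuleCat.{u} k :=
  groupCohomology.H2 (Rep.trivial k G A)

variable {G}

/-- The map `H²(id_G; f) : H²(G; A) ⟶ H²(G; B)` induced by a homomorphism `f : A ⟶ B` of
coefficient modules. -/
def coefficientMap₂ {A B : ModuleCat.{u} k} (f : A ⟶ B) :
    trivialCohomology₂ G A ⟶ trivialCohomology₂ G B :=
  groupCohomology.map (MonoidHom.id G) ((Rep.trivialFunctor k G).map f) 2

/-- Descend a linear map along a surjective linear map. -/
def LinearMap.descend {M N P : Type*} [AddCommGroup M] [AddCommGroup N] [AddCommGroup P]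
    [Module k M] [Module k N] [Module k P] (p : M →ₗ[k] N) (hp : Function.Surjective p)
    (f : M →ₗ[k] P) (h : LinearMap.ker p ≤ LinearMap.ker f) : N →ₗ[k] P :=
  (LinearMap.ker p).liftQ f h ∘ₗ (p.quotKerEquivOfSurjective hp).symm.toLinearMap

theorem LinearMap.descend_apply {M N P : Type*} [AddCommGroup M] [AddCommGroup N]
    [AddCommGroup P] [Module k M] [Module k N] [Module k P] (p : M →ₗ[k] N)
    (hp : Function.Surjective p) (f : M →ₗ[k] P) (h : LinearMap.ker p ≤ LinearMap.ker f) (x : M) :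
    p.descend hp f h (p x) = f x := by
  have : (p.quotKerEquivOfSurjective hp).symm (p x) = (LinearMap.ker p).mkQ x := by
    rw [LinearEquiv.symm_apply_eq]; rfl
  simp [LinearMap.descend, this]

theorem groupHomology_H2π_surjective (A : Rep.{u} k G) :
    Function.Surjective (groupHomology.H2π A).hom := fun y =>
  groupHomology.H2_induction_on y fun x => ⟨x, rfl⟩

theorem groupCohomology_H2π_surjective (A : Rep.{u} k G) :
    Function.Surjective (groupCohomology.H2π A).hom := fun y =>
  groupCohomology.H2_induction_on y fun x => ⟨x, rfl⟩

variable {A : ModuleCat.{u} k}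

theorem kronecker_boundary (c : groupCohomology.cocycles₂ (Rep.trivial k G A))
    (z : G × G →₀ k) (hz : z ∈ groupHomology.boundaries₂ (Rep.trivial k G k)) :
    Finsupp.linearCombination k (fun x : G × G => (c.1 x : A)) z = 0 := by
  obtain ⟨w, rfl⟩ := hz
  induction w using Finsupp.induction_linear with
  | zero => simp
  | add f g hf hg => rw [map_add, map_add, hf, hg, add_zero]
  | single x r =>
    obtain ⟨g, h, j⟩ := x
    have hc : (c.1 (g * h, j) : A) + c.1 (g, h) = c.1 (h, j) + c.1 (g, h * j) :=
      (groupCohomology.mem_cocycles₂_iff c.1).1 c.2 g h j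
    erw [groupHomology.d₃₂_single]
    simp only [map_add, map_sub, Finsupp.linearCombination_single]
    change r • (c.1 (h, j) : A) - r • (c.1 (g * h, j) : A) + r • (c.1 (g, h * j) : A)
      - r • (c.1 (g, h) : A) = 0
    rw [← smul_sub, ← smul_add, ← smul_sub, eq_sub_of_add_eq hc]
    simp [sub_sub_eq_add_sub]

theorem kronecker_coboundary (c : groupCohomology.cocycles₂ (Rep.trivial k G A))
    (hc : c.1 ∈ groupCohomology.coboundaries₂ (Rep.trivial k G A))
    (z : groupHomology.cycles₂ (Rep.trivial k G k)) :
    Finsupp.linearCombination k (fun x : G × G => (c.1 x : A)) z.1 = 0 := by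
  obtain ⟨f, hf⟩ := hc
  have key : ∀ w : G × G →₀ k,
      Finsupp.linearCombination k (fun x : G × G => (c.1 x : A)) w =
        Finsupp.linearCombination k (fun x : G => (f x : A))
          ((groupHomology.d₂₁ (Rep.trivial k G k)).hom w) := by
    intro w
    induction w using Finsupp.induction_linear with
    | zero => simp
    | add f g hf hg => rw [map_add, map_add, map_add, hf, hg]
    | single x r =>
      obtain ⟨g, h⟩ := x
      have hx : (c.1 (g, h) : A) = f h - f (g * h) + f g := (congrFun hf (g, h)).symm
      erw [groupHomology.d₂₁_single]
      simp only [map_add, map_sub, Finsupp.linearCombination_single]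
      change r • (c.1 (g, h) : A) = r • (f h : A) - r • (f (g * h) : A) + r • (f g : A)
      rw [hx, smul_add, smul_sub]
  rw [key, LinearMap.mem_ker.1 z.2, map_zero]

/-- The evaluation `H_2(G; k) → A` of a 2-cocycle `c` of `G` with values in `A`: the class of a
cycle `∑ r_i (g_i, h_i)` is mapped to `∑ r_i c(g_i, h_i)`. -/
def kroneckerCocycle (c : groupCohomology.cocycles₂ (Rep.trivial k G A)) :
    trivialHomology k G 2 →ₗ[k] A :=
  (groupHomology.H2π (Rep.trivial k G k)).hom.descend (groupHomology_H2π_surjective _)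
    (Finsupp.linearCombination k (fun x : G × G => (c.1 x : A)) ∘ₗ
      (groupHomology.cycles₂ (Rep.trivial k G k)).subtype)
    (fun z hz => kronecker_boundary c z.1 ((groupHomology.H2π_eq_zero_iff z).1 hz))

theorem kroneckerCocycle_H2π (c : groupCohomology.cocycles₂ (Rep.trivial k G A))
    (z : groupHomology.cycles₂ (Rep.trivial k G k)) :
    kroneckerCocycle c ((groupHomology.H2π (Rep.trivial k G k)).hom z) =
      Finsupp.linearCombination k (fun x : G × G => (c.1 x : A)) z.1 :=
  LinearMap.descend_apply _ (groupHomology_H2π_surjective _) _ _ z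

/-- The Kronecker pairing `H²(G; A) → Hom_k(H_2(G; k), A)`, `φ ↦ ⟨φ, ·⟩`. -/
def kronecker : trivialCohomology₂ G A →ₗ[k] trivialHomology k G 2 →ₗ[k] A :=
  (groupCohomology.H2π (Rep.trivial k G A)).hom.descend (groupCohomology_H2π_surjective _)
    { toFun := kroneckerCocycle
      map_add' := fun c d => by
        ext y
        obtain ⟨z, rfl⟩ := groupHomology_H2π_surjective _ y
        rw [LinearMap.add_apply]
        erw [kroneckerCocycle_H2π, kroneckerCocycle_H2π, kroneckerCocycle_H2π]
        simp only [Finsupp.linearCombination_apply, Finsupp.sum]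
        rw [← Finset.sum_add_distrib]
        exact Finset.sum_congr rfl fun x _ => smul_add _ (c.1 x : A) (d.1 x)
      map_smul' := fun r c => by
        ext y
        obtain ⟨z, rfl⟩ := groupHomology_H2π_surjective _ y
        rw [RingHom.id_apply, LinearMap.smul_apply]
        erw [kroneckerCocycle_H2π, kroneckerCocycle_H2π]
        simp only [Finsupp.linearCombination_apply, Finsupp.sum]
        rw [Finset.smul_sum]
        exact Finset.sum_congr rfl fun x _ => smul_comm _ r (c.1 x : A) }
    (fun c hc => by
      have hc' := (groupCohomology.H2π_eq_zero_iff c).1 hc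
      refine LinearMap.mem_ker.2 (LinearMap.ext fun y => ?_)
      obtain ⟨z, rfl⟩ := groupHomology_H2π_surjective _ y
      exact (kroneckerCocycle_H2π c z).trans (kronecker_coboundary c hc' z))

/-- The formula for the Kronecker pairing on representatives. -/
theorem kronecker_H2π (c : groupCohomology.cocycles₂ (Rep.trivial k G A))
    (z : groupHomology.cycles₂ (Rep.trivial k G k)) :
    kronecker ((groupCohomology.H2π (Rep.trivial k G A)).hom c)
        ((groupHomology.H2π (Rep.trivial k G k)).hom z) =
      Finsupp.linearCombination k (fun x : G × G => (c.1 x : A)) z.1 := by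
  refine Eq.trans ?_ (kroneckerCocycle_H2π c z)
  exact LinearMap.congr_fun (LinearMap.descend_apply _ (groupCohomology_H2π_surjective _) _ _ c) _

end Kronecker

/-! ### Central extensions -/

/-- The extension `1 → A → E → Γ → 1` is central and its class is `φ ∈ H²(Γ; A)`: for some
set-theoretic section `σ`, the class `φ` is represented by the 2-cocycle `c` that is
given by `σ(g) σ(h) = c(g, h) σ(g h)`. -/
def IsCentralExtensionOfClass {Γ E : Type} [Group Γ] [Group E] {A : ModuleCat.{0} ℤ}
    (S : GroupExtension (Multiplicative A) E Γ) (φ : trivialCohomology₂ Γ A) : Prop :=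
  S.inl.range ≤ Subgroup.center E ∧
    ∃ (σ : S.Section) (c : groupCohomology.cocycles₂ (Rep.trivial ℤ Γ A)),
      (∀ g h : Γ, σ g * σ h = S.inl (Multiplicative.ofAdd (c.1 (g, h) : A)) * σ (g * h)) ∧
      groupCohomology.H2π (Rep.trivial ℤ Γ A) c = φ

/-! ### Quasimorphisms and stable commutator length -/

section Quasimorphisms

/-- The real vector space of quasimorphisms on `G`. -/
def quasimorphisms (G : Type*) [Group G] : Submodule ℝ (G → ℝ) where
  carrier := {f | ∃ D : ℝ, ∀ g h, |f (g * h) - f g - f h| ≤ D}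
  zero_mem' := ⟨0, by simp⟩
  add_mem' := by
    rintro f₁ f₂ ⟨D₁, h₁⟩ ⟨D₂, h₂⟩
    refine ⟨D₁ + D₂, fun g h => ?_⟩
    calc |(f₁ + f₂) (g * h) - (f₁ + f₂) g - (f₁ + f₂) h|
        = |(f₁ (g * h) - f₁ g - f₁ h) + (f₂ (g * h) - f₂ g - f₂ h)| := by
          simp only [Pi.add_apply]; ring_nf
      _ ≤ D₁ + D₂ := (abs_add_le _ _).trans (add_le_add (h₁ g h) (h₂ g h))
  smul_mem' := by
    rintro r f ⟨D, hD⟩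
    refine ⟨|r| * D, fun g h => ?_⟩
    simp only [Pi.smul_apply, smul_eq_mul]
    rw [← mul_sub, ← mul_sub, abs_mul]
    exact mul_le_mul_of_nonneg_left (hD g h) (abs_nonneg r)

/-- The trivial quasimorphisms: those at bounded distance from a homomorphism to `ℝ`. -/
def trivialQuasimorphisms (G : Type*) [Group G] : Submodule ℝ (quasimorphisms G) where
  carrier := {f | ∃ (χ : Additive G →+ ℝ) (C : ℝ), ∀ g, |f.1 g - χ (Additive.ofMul g)| ≤ C}
  zero_mem' := ⟨0, 0, by simp⟩
  add_mem' := by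
    rintro f₁ f₂ ⟨χ₁, C₁, h₁⟩ ⟨χ₂, C₂, h₂⟩
    refine ⟨χ₁ + χ₂, C₁ + C₂, fun g => ?_⟩
    have : (f₁ + f₂).1 g - (χ₁ + χ₂) (Additive.ofMul g) =
        (f₁.1 g - χ₁ (Additive.ofMul g)) + (f₂.1 g - χ₂ (Additive.ofMul g)) := by
      simp only [Submodule.coe_add, Pi.add_apply, AddMonoidHom.add_apply]; ring
    rw [this]
    exact (abs_add_le _ _).trans (add_le_add (h₁ g) (h₂ g))
  smul_mem' := by
    rintro r f ⟨χ, C, hC⟩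
    refine ⟨(AddMonoidHom.mulLeft r).comp χ, |r| * C, fun g => ?_⟩
    have : (r • f).1 g - ((AddMonoidHom.mulLeft r).comp χ) (Additive.ofMul g) =
        r * (f.1 g - χ (Additive.ofMul g)) := by
      simp [mul_sub]
    rw [this, abs_mul]
    exact mul_le_mul_of_nonneg_left (hC g) (abs_nonneg r)

/-- The space `Q(G)` of quasimorphisms modulo trivial quasimorphisms. -/
abbrev QuasimorphismSpace (G : Type*) [Group G] : Type _ :=
  quasimorphisms G ⧸ trivialQuasimorphisms G

/-- Precomposition of quasimorphisms with a homomorphism. -/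
def quasimorphismComp {G G' : Type*} [Group G] [Group G'] (ψ : G →* G') :
    quasimorphisms G' →ₗ[ℝ] quasimorphisms G where
  toFun f := ⟨f.1 ∘ ψ, by
    obtain ⟨D, hD⟩ := f.2
    exact ⟨D, fun g h => by simpa using hD (ψ g) (ψ h)⟩⟩
  map_add' _ _ := rfl
  map_smul' _ _ := rfl

/-- The map `Q(ψ) : Q(G') → Q(G)`, `[f] ↦ [f ∘ ψ]`. -/
def quasimorphismMap {G G' : Type*} [Group G] [Group G'] (ψ : G →* G') :
    QuasimorphismSpace G' →ₗ[ℝ] QuasimorphismSpace G :=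
  Submodule.mapQ _ _ (quasimorphismComp ψ) (by
    rintro f ⟨χ, C, hC⟩
    exact ⟨χ.comp (MonoidHom.toAdditive ψ), C, fun g => hC (ψ g)⟩)

/-- The commutator length of `g`: the least number of commutators whose product is `g`
(only meaningful for `g` in the commutator subgroup). -/
def commutatorLength {G : Type*} [Group G] (g : G) : ℕ :=
  sInf {n | ∃ l : List G, l.length = n ∧ (∀ x ∈ l, x ∈ commutatorSet G) ∧ l.prod = g}

/-- The stable commutator length `scl g = lim_{n → ∞} cl(g ^ n) / n`
(only meaningful for `g` in the commutator subgroup, where the limit exists). -/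
def scl {G : Type*} [Group G] (g : G) : ℝ :=
  Filter.limUnder Filter.atTop fun n : ℕ => (commutatorLength (g ^ n) : ℝ) / n

end Quasimorphisms

/-! ### Second bounded cohomology with real coefficients -/

section BoundedCohomology

/-- Bounded real 2-cocycles. -/
def boundedCocycles₂ (G : Type) [Group G] : Submodule ℝ (G × G → ℝ) where
  carrier := {c | c ∈ groupCohomology.cocycles₂ (Rep.trivial ℝ G ℝ) ∧ ∃ C : ℝ, ∀ x, |c x| ≤ C}
  zero_mem' := ⟨Submodule.zero_mem _, 0, by simp⟩
  add_mem' := by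
    rintro c₁ c₂ ⟨h₁, C₁, hC₁⟩ ⟨h₂, C₂, hC₂⟩
    exact ⟨Submodule.add_mem _ h₁ h₂, C₁ + C₂,
      fun x => (abs_add_le _ _).trans (add_le_add (hC₁ x) (hC₂ x))⟩
  smul_mem' := by
    rintro r c ⟨h, C, hC⟩
    refine ⟨Submodule.smul_mem _ r h, |r| * C, fun x => ?_⟩
    rw [Pi.smul_apply, smul_eq_mul, abs_mul]
    exact mul_le_mul_of_nonneg_left (hC x) (abs_nonneg r)

/-- Coboundaries of bounded real 1-cochains. -/
def boundedCoboundaries₂ (G : Type) [Group G] : Submodule ℝ (boundedCocycles₂ G) where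
  carrier := {c | ∃ f : G → ℝ, (∃ C : ℝ, ∀ g, |f g| ≤ C) ∧
    ∀ g h, c.1 (g, h) = f h - f (g * h) + f g}
  zero_mem' := ⟨0, ⟨0, by simp⟩, by simp⟩
  add_mem' := by
    rintro c₁ c₂ ⟨f₁, ⟨C₁, hC₁⟩, h₁⟩ ⟨f₂, ⟨C₂, hC₂⟩, h₂⟩
    refine ⟨f₁ + f₂, ⟨C₁ + C₂, fun x => (abs_add_le _ _).trans (add_le_add (hC₁ x) (hC₂ x))⟩,
      fun g h => ?_⟩
    simp only [Submodule.coe_add, Pi.add_apply, h₁, h₂]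
    ring
  smul_mem' := by
    rintro r c ⟨f, ⟨C, hC⟩, h⟩
    refine ⟨r • f, ⟨|r| * C, fun x => ?_⟩, fun g h' => ?_⟩
    · rw [Pi.smul_apply, smul_eq_mul, abs_mul]
      exact mul_le_mul_of_nonneg_left (hC x) (abs_nonneg r)
    · simp only [Submodule.coe_smul, Pi.smul_apply, smul_eq_mul, h]
      ring

/-- The second bounded cohomology `H²_b(G; ℝ)`. -/
abbrev BoundedCohomology₂ (G : Type) [Group G] : Type :=
  boundedCocycles₂ G ⧸ boundedCoboundaries₂ G

end BoundedCohomology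

/-! ### Actions on the circle and the Euler class -/

section Euler

/-- The group `Homeo⁺(S¹)` of orientation preserving homeomorphisms of `S¹ = ℝ/ℤ`, i.e., of
those homeomorphisms that lift to an increasing bijection `F : ℝ → ℝ` with
`F (x + 1) = F x + 1`. -/
def HomeoPlus : Subgroup (UnitAddCircle ≃ₜ UnitAddCircle) where
  carrier := {h | ∃ F : CircleDeg1Liftˣ, ∀ x : ℝ, h (x : UnitAddCircle) = (F x : UnitAddCircle)}
  one_mem' := ⟨1, fun _ => rfl⟩
  mul_mem' := by
    rintro h₁ h₂ ⟨F₁, hF₁⟩ ⟨F₂, hF₂⟩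
    refine ⟨F₁ * F₂, fun x => ?_⟩
    change h₁ (h₂ x) = _
    rw [hF₂, hF₁]
    rfl
  inv_mem' := by
    rintro h ⟨F, hF⟩
    refine ⟨F⁻¹, fun x => ?_⟩
    change h.symm x = _
    rw [Homeomorph.symm_apply_eq, hF, CircleDeg1Lift.units_apply_inv_apply]

theorem exists_circleLift (h : HomeoPlus) : ∃ F : CircleDeg1Liftˣ,
    (∀ x : ℝ, h.1 (x : UnitAddCircle) = (F x : UnitAddCircle)) ∧ F 0 ∈ Set.Ico (0 : ℝ) 1 := by
  obtain ⟨F, hF⟩ := h.2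
  refine ⟨CircleDeg1Lift.translate (Multiplicative.ofAdd (-(⌊F 0⌋ : ℝ))) * F, fun x => ?_, ?_, ?_⟩
  · rw [hF, Units.val_mul, CircleDeg1Lift.mul_apply, CircleDeg1Lift.translate_apply,
      eq_comm, ← sub_eq_zero, ← AddCircle.coe_sub, AddCircle.coe_eq_zero_iff]
    exact ⟨-⌊F 0⌋, by simp⟩
  · rw [Units.val_mul, CircleDeg1Lift.mul_apply, CircleDeg1Lift.translate_apply]
    linarith [Int.floor_le (F 0)]
  · rw [Units.val_mul, CircleDeg1Lift.mul_apply, CircleDeg1Lift.translate_apply]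
    linarith [Int.lt_floor_add_one (F 0)]

/-- The lift `F` of an orientation preserving homeomorphism that is normalised by
`F 0 ∈ [0, 1)`. -/
def circleLift (h : HomeoPlus) : CircleDeg1Liftˣ := (exists_circleLift h).choose

theorem coe_circleLift (h : HomeoPlus) (x : ℝ) :
    h.1 (x : UnitAddCircle) = (circleLift h x : UnitAddCircle) := (exists_circleLift h).choose_spec.1 x

theorem circleLift_zero_mem (h : HomeoPlus) : circleLift h 0 ∈ Set.Ico (0 : ℝ) 1 :=
  (exists_circleLift h).choose_spec.2

theorem CircleDeg1Lift.eq_add_int_of_coe_eq (K : CircleDeg1Lift)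
    (hK : ∀ x : ℝ, (K x : UnitAddCircle) = x) (x : ℝ) : K x = x + K 0 := by
  have hint : ∀ y : ℝ, ∃ n : ℤ, K y = y + n := fun y => by
    have := hK y
    rw [← sub_eq_zero, ← AddCircle.coe_sub, AddCircle.coe_eq_zero_iff] at this
    obtain ⟨n, hn⟩ := this
    exact ⟨n, by rw [zsmul_one] at hn; linarith⟩
  have hfr : K (Int.fract x) = Int.fract x + K 0 := by
    obtain ⟨n, hn⟩ := hint (Int.fract x)
    obtain ⟨m, hm⟩ := hint 0
    have h1 := K.mono (Int.fract_nonneg x)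
    have h2 := K.mono (Int.fract_lt_one x).le
    have h3 : K 1 = K 0 + 1 := by simpa using K.map_add_one 0
    have h4 := Int.fract_nonneg x
    have h5 := Int.fract_lt_one x
    rcases h4.eq_or_lt with h | h
    · rw [← h]; simp
    have : m = n := by
      have a1 : (m : ℝ) < n + 1 := by linarith
      have a2 : (n : ℝ) < m + 1 := by linarith
      have b1 : m < n + 1 := by exact_mod_cast a1
      have b2 : n < m + 1 := by exact_mod_cast a2
      omega
    rw [hn, hm, this, zero_add]
  have : K x = K (Int.fract x) + ⌊x⌋ := by
    rw [← K.map_add_int, Int.fract_add_floor]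
  rw [this, hfr]
  linarith [Int.fract_add_floor x]

variable {Γ : Type} [Group Γ] (ρ : Γ →* HomeoPlus)

/-- The integral Euler cocycle of an orientation preserving action on the circle: with `g̃` the
lift of `ρ(g)` such that `g̃(0) ∈ [0, 1)`, the integer `c(g, h)` is determined by
`g̃ ∘ h̃ = (gh)~ + c(g, h)` (see `circleLift_comp`), i.e., `c(g, h) = ⌊g̃(h̃(0))⌋`. -/
def eulerCocycle (x : Γ × Γ) : ℤ := ⌊(circleLift (ρ x.1)) ((circleLift (ρ x.2)) 0)⌋

theorem circleLift_comp (g h : Γ) (x : ℝ) :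
    (circleLift (ρ g)) ((circleLift (ρ h)) x) = (circleLift (ρ (g * h))) x + eulerCocycle ρ (g, h) := by
  have key : ∀ y, (circleLift (ρ g)) ((circleLift (ρ h)) (((circleLift (ρ (g * h)))⁻¹ : CircleDeg1Liftˣ) y)) =
      y + ((circleLift (ρ g)) * (circleLift (ρ h)) * (circleLift (ρ (g * h)))⁻¹ : CircleDeg1Liftˣ) 0 := fun y => by
    refine CircleDeg1Lift.eq_add_int_of_coe_eq
      ((circleLift (ρ g)) * (circleLift (ρ h)) * (circleLift (ρ (g * h)))⁻¹ : CircleDeg1Liftˣ) (fun z => ?_) y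
    change (((circleLift (ρ g)) ((circleLift (ρ h)) (((circleLift (ρ (g * h)))⁻¹ : CircleDeg1Liftˣ) z)) : ℝ) :
      UnitAddCircle) = z
    rw [← coe_circleLift, ← coe_circleLift]
    have : ∀ w : UnitAddCircle, (ρ g).1 ((ρ h).1 w) = (ρ (g * h)).1 w := fun w => by
      rw [map_mul]; rfl
    rw [this, coe_circleLift, CircleDeg1Lift.units_apply_inv_apply]
  set t := ((circleLift (ρ g)) * (circleLift (ρ h)) * (circleLift (ρ (g * h)))⁻¹ : CircleDeg1Liftˣ) 0 with ht
  have key' : ∀ x, (circleLift (ρ g)) ((circleLift (ρ h)) x) = (circleLift (ρ (g * h))) x + t := fun x => by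
    simpa using key ((circleLift (ρ (g * h))) x)
  have hz : ∃ n : ℤ, t = n := by
    have h0 : (((circleLift (ρ g)) * (circleLift (ρ h)) * (circleLift (ρ (g * h)))⁻¹ : CircleDeg1Liftˣ) 0 :
        UnitAddCircle) = (0 : ℝ) := by
      change (((circleLift (ρ g)) ((circleLift (ρ h)) (((circleLift (ρ (g * h)))⁻¹ : CircleDeg1Liftˣ) 0)) : ℝ) :
        UnitAddCircle) = (0 : ℝ)
      rw [← coe_circleLift, ← coe_circleLift]
      have : ∀ w : UnitAddCircle, (ρ g).1 ((ρ h).1 w) = (ρ (g * h)).1 w := fun w => by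
        rw [map_mul]; rfl
      rw [this, coe_circleLift, CircleDeg1Lift.units_apply_inv_apply]
    rw [AddCircle.coe_zero, AddCircle.coe_eq_zero_iff] at h0
    obtain ⟨n, hn⟩ := h0
    exact ⟨n, by rw [ht, ← hn]; simp⟩
  obtain ⟨n, hn⟩ := hz
  have : eulerCocycle ρ (g, h) = n := by
    have h1 := circleLift_zero_mem (ρ (g * h))
    rw [eulerCocycle, Int.floor_eq_iff]
    simp only [key' 0, hn]
    exact ⟨by linarith [h1.1], by linarith [h1.2]⟩
  rw [key', hn, this]

theorem eulerCocycle_identity (g h j : Γ) :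
    eulerCocycle ρ (g * h, j) + eulerCocycle ρ (g, h) =
      eulerCocycle ρ (h, j) + eulerCocycle ρ (g, h * j) := by
  have h1 := circleLift_comp ρ g h ((circleLift (ρ j)) 0)
  rw [circleLift_comp ρ h j, CircleDeg1Lift.map_add_int, circleLift_comp ρ g (h * j),
    circleLift_comp ρ (g * h) j, mul_assoc] at h1
  have h2 : ((eulerCocycle ρ (g * h, j) + eulerCocycle ρ (g, h) : ℤ) : ℝ) =
      ((eulerCocycle ρ (h, j) + eulerCocycle ρ (g, h * j) : ℤ) : ℝ) := by
    push_cast; linarith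
  exact_mod_cast h2

theorem eulerCocycle_mem (x : Γ × Γ) : 0 ≤ eulerCocycle ρ x ∧ eulerCocycle ρ x ≤ 1 := by
  have hg := circleLift_zero_mem (ρ x.1)
  have hh := circleLift_zero_mem (ρ x.2)
  have h1 := CircleDeg1Lift.mono (circleLift (ρ x.1)) hh.1
  have h2 := CircleDeg1Lift.mono (circleLift (ρ x.1)) hh.2.le
  have h3 : (circleLift (ρ x.1)) 1 = (circleLift (ρ x.1)) 0 + 1 := by
    simpa using CircleDeg1Lift.map_add_one (circleLift (ρ x.1)) 0
  constructor
  · exact Int.floor_nonneg.2 (hg.1.trans h1)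
  · have : eulerCocycle ρ x < 2 := by
      rw [eulerCocycle, Int.floor_lt]; push_cast; linarith [hg.2]
    omega

/-- The integral Euler class in `H²(Γ; ℤ)`. -/
def eulerClass : trivialCohomology₂ Γ (ModuleCat.of ℤ ℤ) :=
  groupCohomology.H2π (Rep.trivial ℤ Γ (ModuleCat.of ℤ ℤ))
    ⟨eulerCocycle ρ, (groupCohomology.mem_cocycles₂_iff _).2 (eulerCocycle_identity ρ)⟩

/-- The (real) bounded Euler class in `H²_b(Γ; ℝ)`. -/
def boundedEulerClass : BoundedCohomology₂ Γ :=
  Submodule.Quotient.mk ⟨fun x => (eulerCocycle ρ x : ℝ),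
    (groupCohomology.mem_cocycles₂_iff _).2 fun g h j => by
      change (eulerCocycle ρ (g * h, j) : ℝ) + eulerCocycle ρ (g, h) =
        eulerCocycle ρ (h, j) + eulerCocycle ρ (g, h * j)
      exact_mod_cast eulerCocycle_identity ρ g h j,
    1, fun x => by
      have h := eulerCocycle_mem ρ x
      have h0 : (0 : ℝ) ≤ eulerCocycle ρ x := by exact_mod_cast h.1
      have h1 : (eulerCocycle ρ x : ℝ) ≤ 1 := by exact_mod_cast h.2
      rw [abs_of_nonneg h0]
      exact h1⟩

/-- The standing assumptions on a group `Γ` with an orientation preserving action `ρ` on `S¹`. -/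
structure EulerSetup : Prop where
  finitelyPresented : Group.IsFinitelyPresented Γ
  finite_H1 : Finite (trivialHomology ℤ Γ 1)
  quasimorphism_trivial : ∀ f : quasimorphisms Γ, f ∈ trivialQuasimorphisms Γ
  finrank_boundedCohomology : Module.finrank ℝ (BoundedCohomology₂ Γ) = 1
  span_boundedEulerClass : Submodule.span ℝ {boundedEulerClass ρ} = ⊤

end Euler

end

/-! Quasimorphisms. In a central extension of `Γ` by `A` with cocycle `c`, an element is a fibre
coordinate in `A` together with a point of `Γ`. If a homomorphism `χ : A → ℝ` satisfies `χ ∘ c =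
eulerCocycle + δb`, then `χ ∘ coord + b ∘ π` is a quasimorphism whose deviation from additivity is
the Euler cocycle. Up to bounded error and scaling it is the only one
(`exists_near_coordQuasimorphism`). Indeed, a quasimorphism restricts to the fibre as a homomorphism
`l` up to bounded error, and its values on a section turn `l ∘ c` into a bounded cocycle on `Γ`, so
into `t • eu_b`. The evaluation of `c` hits `m • A`, which forces `l = t • χ`. What is left is a
quasimorphism on `Γ`, hence bounded. This applies to `E` (with `χ = ε`) and to the Euler extension
(with `χ = id`), so both `Q`-spaces are lines. Pullback along an epimorphism is injective because
`E` has no homomorphisms to `ℝ`.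

The classes. If `⟨eu, ·⟩` vanished, the Euler cocycle would be `δf` with `f` a quasimorphism, hence
bounded, and `eu_b` would be zero; so `m > 0`. The class `φ` comes from the universal coefficient
theorem, corrected along a splitting of `ε`.

Real homology. A real cocycle on `E` defines an extension of `E` by `ℝ` that is also central over
`Γ`. Pushing it out to an extension of `Γ` by `ℝ` and subtracting a multiple of `c` with the same
evaluation splits it (`exists_real_coboundary`).

Stable commutator length. All quasimorphisms on `E` are bounded on the powers of an element of `ker
ψ`. By the Hahn-Banach half of Bavard duality such an element bounds chains of small norm, which
become products of few commutators (`exists_isCommutatorProduct_pow`). A central kernel of this kind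
is invisible to `scl` (`scl_map_eq`). -/

/-! ### Products of commutators and stable commutator length. -/

section CommutatorProducts

open scoped commutatorElement

variable {G : Type*} [Group G]

/-- `g` is a product of at most `k` commutators. -/
def IsCommutatorProduct (k : ℕ) (g : G) : Prop :=
  ∃ l : List G, l.length ≤ k ∧ (∀ x ∈ l, x ∈ commutatorSet G) ∧ l.prod = g

namespace IsCommutatorProduct

theorem one (k : ℕ) : IsCommutatorProduct k (1 : G) := ⟨[], by simp, by simp, rfl⟩

theorem mono {k k' : ℕ} (h : k ≤ k') {g : G} : IsCommutatorProduct k g → IsCommutatorProduct k' g :=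
  fun ⟨l, hl, hc, hp⟩ => ⟨l, hl.trans h, hc, hp⟩

theorem mul {k k' : ℕ} {g g' : G} : IsCommutatorProduct k g → IsCommutatorProduct k' g' →
    IsCommutatorProduct (k + k') (g * g') := by
  rintro ⟨l, hl, hc, rfl⟩ ⟨l', hl', hc', rfl⟩
  refine ⟨l ++ l', by simp; omega, fun x hx => ?_, by simp⟩
  rcases List.mem_append.1 hx with h | h
  exacts [hc x h, hc' x h]

theorem of_commutator (a b : G) : IsCommutatorProduct 1 ⁅a, b⁆ :=
  ⟨[⁅a, b⁆], by simp, by simp [commutator_mem_commutatorSet], by simp⟩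

theorem map {G' : Type*} [Group G'] (f : G →* G') {k : ℕ} {g : G} :
    IsCommutatorProduct k g → IsCommutatorProduct k (f g) := by
  rintro ⟨l, hl, hc, rfl⟩
  refine ⟨l.map f, by simpa using hl, ?_, (map_list_prod f l).symm⟩
  simp only [List.mem_map, forall_exists_index, and_imp, forall_apply_eq_imp_iff₂]
  intro x hx
  obtain ⟨a, b, rfl⟩ := hc x hx
  rw [map_commutatorElement]
  exact commutator_mem_commutatorSet _ _

theorem conj {k : ℕ} {g : G} (x : G) (h : IsCommutatorProduct k g) :
    IsCommutatorProduct k (x * g * x⁻¹) := by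
  simpa using h.map (MulAut.conj x).toMonoidHom

theorem pow {k : ℕ} {g : G} (h : IsCommutatorProduct k g) (n : ℕ) :
    IsCommutatorProduct (n * k) (g ^ n) := by
  induction n with
  | zero => rw [pow_zero]; exact one _
  | succ n ih => rw [pow_succ, add_mul, one_mul]; exact ih.mul h

/-- Both entries of each commutator lift along a surjection, so lifting costs no further
commutators. -/
theorem exists_lift {G' : Type*} [Group G'] (f : G →* G') (hf : Function.Surjective f) {k : ℕ}
    {g : G'} (h : IsCommutatorProduct k g) : ∃ x, f x = g ∧ IsCommutatorProduct k x := by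
  obtain ⟨l, hl, hc, rfl⟩ := h
  induction l generalizing k with
  | nil => exact ⟨1, by simp, one _⟩
  | cons y l ih =>
    obtain ⟨a', b', rfl⟩ := hc y (by simp)
    obtain ⟨a, rfl⟩ := hf a'
    obtain ⟨b, rfl⟩ := hf b'
    obtain ⟨x, hx, hxk⟩ := ih le_rfl fun z hz => hc z (List.mem_cons_of_mem _ hz)
    refine ⟨⁅a, b⁆ * x, by simp [hx, map_commutatorElement], ((of_commutator a b).mul hxk).mono ?_⟩
    simpa [add_comm] using hl

theorem mem_commutator {k : ℕ} {g : G} : IsCommutatorProduct k g → g ∈ commutator G := by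
  rintro ⟨l, -, hc, rfl⟩
  refine Subgroup.list_prod_mem _ fun x hx => ?_
  rw [commutator_eq_closure]
  exact Subgroup.subset_closure (hc x hx)

theorem exists_of_mem {g : G} (hg : g ∈ commutator G) : ∃ k, IsCommutatorProduct k g := by
  rw [commutator_eq_closure] at hg
  induction hg using Subgroup.closure_induction with
  | mem x hx => obtain ⟨a, b, rfl⟩ := hx; exact ⟨1, of_commutator a b⟩
  | one => exact ⟨0, one 0⟩
  | mul x y _ _ hx hy =>
    obtain ⟨k, hk⟩ := hx
    obtain ⟨l, hl⟩ := hy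
    exact ⟨k + l, hk.mul hl⟩
  | inv x _ hx =>
    obtain ⟨k, l, hl, hc, rfl⟩ := hx
    refine ⟨k, (l.map (·⁻¹)).reverse, by simpa, ?_, by rw [List.prod_inv_reverse]⟩
    simp only [List.mem_reverse, List.mem_map, forall_exists_index, and_imp,
      forall_apply_eq_imp_iff₂]
    intro x hx
    obtain ⟨a, b, rfl⟩ := hc x hx
    rw [commutatorElement_inv]
    exact commutator_mem_commutatorSet _ _

/-- Rearranging the factors of a product costs at most one commutator per factor. -/
theorem prod_mul_inv_of_perm {P Q : List G} (h : P.Perm Q) :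
    IsCommutatorProduct P.length (P.prod * Q.prod⁻¹) := by
  classical
  induction P generalizing Q with
  | nil => rw [List.nil_perm.1 h]; simpa using one 0
  | cons x P ih =>
    -- Moving `x` to the front past `Q₁` costs the single commutator `⁅x, Q₁.prod⁆`.
    obtain ⟨Q₁, Q₂, rfl⟩ := List.append_of_mem (h.subset (by simp : x ∈ x :: P))
    have h' : P.Perm (Q₁ ++ Q₂) := (h.trans List.perm_middle).cons_inv
    have := ((ih h').conj x).mul (of_commutator x Q₁.prod)
    have heq : (x :: P).prod * (Q₁ ++ x :: Q₂).prod⁻¹ =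
        x * (P.prod * (Q₁ ++ Q₂).prod⁻¹) * x⁻¹ * ⁅x, Q₁.prod⁆ := by
      simp only [List.prod_cons, List.prod_append, commutatorElement_def]
      group
    rwa [heq]

end IsCommutatorProduct

open IsCommutatorProduct

/-- Membership in the commutator subgroup makes the set of lengths nonempty, so that the infimum is
attained and is not the default value `0`. -/
theorem isCommutatorProduct_commutatorLength {g : G} (hg : g ∈ commutator G) :
    IsCommutatorProduct (commutatorLength g) g := by
  obtain ⟨k, l, -, hc, hp⟩ := exists_of_mem hg
  have hne : {n | ∃ l : List G, l.length = n ∧ (∀ x ∈ l, x ∈ commutatorSet G) ∧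
      l.prod = g}.Nonempty := ⟨_, l, rfl, hc, hp⟩
  obtain ⟨l, hl, hc, hp⟩ := Nat.sInf_mem hne
  exact ⟨l, hl.le, hc, hp⟩

theorem commutatorLength_le {k : ℕ} {g : G} (h : IsCommutatorProduct k g) :
    commutatorLength g ≤ k := by
  obtain ⟨l, hl, hc, hp⟩ := h
  refine le_trans (Nat.sInf_le ?_) hl
  exact ⟨l, rfl, hc, hp⟩

theorem subadditive_commutatorLength {g : G} (hg : g ∈ commutator G) :
    Subadditive fun n : ℕ => (commutatorLength (g ^ n) : ℝ) := by
  intro m n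
  beta_reduce
  rw [pow_add]
  exact_mod_cast commutatorLength_le
    ((isCommutatorProduct_commutatorLength (pow_mem hg m)).mul
      (isCommutatorProduct_commutatorLength (pow_mem hg n)))

theorem bddBelow_commutatorLength_div (g : G) :
    BddBelow (Set.range fun n : ℕ => (commutatorLength (g ^ n) : ℝ) / n) :=
  ⟨0, by rintro _ ⟨n, rfl⟩; positivity⟩

theorem tendsto_scl {g : G} (hg : g ∈ commutator G) :
    Filter.Tendsto (fun n : ℕ => (commutatorLength (g ^ n) : ℝ) / n) Filter.atTop
      (nhds (scl g)) := by
  have := (subadditive_commutatorLength hg).tendsto_lim (bddBelow_commutatorLength_div g)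
  rw [scl, this.limUnder_eq]
  exact this

theorem scl_le_div {g : G} (hg : g ∈ commutator G) {n : ℕ} (hn : n ≠ 0) :
    scl g ≤ commutatorLength (g ^ n) / n := by
  have := (subadditive_commutatorLength hg).tendsto_lim (bddBelow_commutatorLength_div g)
  rw [scl, this.limUnder_eq]
  exact (subadditive_commutatorLength hg).lim_le_div (bddBelow_commutatorLength_div g) hn

/-- A surjective homomorphism whose kernel is central and consists, within the commutator
subgroup, of elements with sublinearly growing commutator length preserves `scl`. -/
theorem scl_map_eq {G' : Type*} [Group G'] (ψ : G →* G') (hψ : Function.Surjective ψ)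
    (hcent : ψ.ker ≤ Subgroup.center G)
    (hker : ∃ C : ℕ, ∀ h ∈ ψ.ker, h ∈ commutator G → ∀ n : ℕ, 0 < n →
      ∃ N : ℕ, 0 < N ∧ IsCommutatorProduct (C * N) (h ^ (n * N)))
    {g : G} (hg : g ∈ commutator G) : scl g = scl (ψ g) := by
  have hψg : ψ g ∈ commutator G' := by
    obtain ⟨k, hk⟩ := exists_of_mem hg
    exact (hk.map ψ).mem_commutator
  refine le_antisymm ?_ (le_of_tendsto_of_tendsto' (tendsto_scl hψg) (tendsto_scl hg) fun n => ?_)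
  · refine ge_of_tendsto (tendsto_scl hψg) (Filter.eventually_atTop.2 ⟨1, fun n hn => ?_⟩)
    obtain ⟨C, hC⟩ := hker
    have hk := isCommutatorProduct_commutatorLength (pow_mem hψg n)
    set k := commutatorLength (ψ g ^ n)
    -- The elements `x` and `g ^ n` have the same image, so they differ by a central element of the
    -- kernel that lies in the commutator subgroup.
    obtain ⟨x, hx, hxk⟩ := hk.exists_lift ψ hψ
    have hhker : x⁻¹ * g ^ n ∈ ψ.ker := by simp [MonoidHom.mem_ker, hx]
    have hhcomm : x⁻¹ * g ^ n ∈ commutator G :=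
      mul_mem (inv_mem hxk.mem_commutator) (pow_mem hg n)
    have hn' : (0 : ℝ) < n := by exact_mod_cast hn
    -- With `h = x⁻¹ * g ^ n`, the power `g ^ (n * j * N)` is `x ^ (j * N) * h ^ (j * N)`. The first
    -- factor costs `j * N * k` commutators, the second only `C * N`; the error disappears as `j →
    -- ∞`.
    have key : ∀ j : ℕ, 0 < j → scl g ≤ k / n + C / (n * j) := by
      intro j hj
      obtain ⟨N, hN, hNh⟩ := hC _ hhker hhcomm j hj
      have hcomm : Commute x (x⁻¹ * g ^ n) := Subgroup.mem_center_iff.1 (hcent hhker) x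
      have heq : g ^ (n * (j * N)) = x ^ (j * N) * (x⁻¹ * g ^ n) ^ (j * N) := by
        rw [← hcomm.mul_pow, mul_inv_cancel_left, pow_mul]
      have hle := commutatorLength_le (heq ▸ (hxk.pow (j * N)).mul hNh)
      have hne : n * (j * N) ≠ 0 := by positivity
      refine (scl_le_div hg hne).trans ?_
      have hj' : (0 : ℝ) < j := by exact_mod_cast hj
      have hN' : (0 : ℝ) < N := by exact_mod_cast hN
      have hle' : (commutatorLength (g ^ (n * (j * N))) : ℝ) ≤ j * N * k + C * N := by
        exact_mod_cast hle
      rw [div_le_iff₀ (by push_cast; positivity)]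
      refine hle'.trans (le_of_eq ?_)
      push_cast
      field_simp
    have hlim : Filter.Tendsto (fun j : ℕ => (k : ℝ) / n + C / (n * j)) Filter.atTop
        (nhds (k / n + 0)) := by
      refine tendsto_const_nhds.add ?_
      simp_rw [← div_div]
      exact tendsto_const_div_atTop_nhds_zero_nat _
    rw [add_zero] at hlim
    exact ge_of_tendsto hlim (Filter.eventually_atTop.2 ⟨1, fun j hj => key j hj⟩)
  · gcongr
    rw [← map_pow]
    exact commutatorLength_le ((isCommutatorProduct_commutatorLength (pow_mem hg n)).map ψ)

theorem scl_image_commutator_eq {G' : Type*} [Group G'] (ψ : G →* G') (hψ : Function.Surjective ψ)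
    (hcent : ψ.ker ≤ Subgroup.center G)
    (hker : ∃ C : ℕ, ∀ h ∈ ψ.ker, h ∈ commutator G → ∀ n : ℕ, 0 < n →
      ∃ N : ℕ, 0 < N ∧ IsCommutatorProduct (C * N) (h ^ (n * N))) :
    scl '' (commutator G : Set G) = scl '' (commutator G' : Set G') := by
  ext t
  constructor
  · rintro ⟨g, hg, rfl⟩
    obtain ⟨k, hk⟩ := exists_of_mem hg
    exact ⟨ψ g, (hk.map ψ).mem_commutator, (scl_map_eq ψ hψ hcent hker hg).symm⟩
  · rintro ⟨g', hg', rfl⟩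
    obtain ⟨k, hk⟩ := exists_of_mem hg'
    obtain ⟨g, rfl, hgk⟩ := hk.exists_lift ψ hψ
    exact ⟨g, hgk.mem_commutator, scl_map_eq ψ hψ hcent hker hgk.mem_commutator⟩

end CommutatorProducts

/-! ### Fillings by bar chains and Bavard duality. -/

section Fillings

variable {G : Type*} [Group G]

/-- The boundary of bar 2-chains, `(g, h) ↦ g + h - gh`. -/
noncomputable def barBoundary (R : Type*) [Ring R] : (G × G →₀ R) →ₗ[R] (G →₀ R) :=
  Finsupp.lmapDomain R R Prod.fst + Finsupp.lmapDomain R R Prod.snd -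
    Finsupp.lmapDomain R R (fun x => x.1 * x.2)

theorem barBoundary_single {R : Type*} [Ring R] (x : G × G) (r : R) :
    barBoundary R (Finsupp.single x r) =
      Finsupp.single x.1 r + Finsupp.single x.2 r - Finsupp.single (x.1 * x.2) r := by
  simp [barBoundary]

theorem barBoundary_mapRange {R S : Type*} [Ring R] [Ring S] (f : R →+ S) (w : G × G →₀ R) :
    barBoundary S (Finsupp.mapRange.addMonoidHom f w) =
      Finsupp.mapRange.addMonoidHom f (barBoundary R w) := by
  induction w using Finsupp.induction_linear with
  | zero => simp
  | add u v hu hv => simp only [map_add, hu, hv]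
  | single x r => simp [barBoundary_single, map_add, map_sub]

/-- The positive and the negative terms are listed separately, with multiplicity, so that a chain
can be read as words in the group. -/
theorem exists_lists_barBoundary (w : G × G →₀ ℤ) : ∃ J J' : List (G × G),
    J.length + J'.length ≤ w.sum (fun _ n => n.natAbs) ∧
    (J.map fun x => barBoundary ℤ (Finsupp.single x 1)).sum =
      barBoundary ℤ w + (J'.map fun x => barBoundary ℤ (Finsupp.single x 1)).sum := by
  classical
  induction w using Finsupp.induction with
  | zero => exact ⟨[], [], by simp⟩
  | single_add x n w hx hn ih =>
    obtain ⟨J, J', hlen, hsum⟩ := ih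
    have hs : (Finsupp.single x n + w).sum (fun _ n => n.natAbs) =
        n.natAbs + w.sum (fun _ n => n.natAbs) := by
      rw [Finsupp.sum_add_index_of_disjoint, Finsupp.sum_single_index (by simp)]
      exact (Finset.disjoint_singleton_left.2 hx).mono_left Finsupp.support_single_subset
    have hb : barBoundary ℤ (Finsupp.single x n) = n • barBoundary ℤ (Finsupp.single x 1) := by
      rw [← map_smul]; simp
    rw [hs, map_add, hb]
    obtain ⟨k, rfl | rfl⟩ := n.eq_nat_or_neg
    · refine ⟨List.replicate k x ++ J, J', by simp; omega, ?_⟩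
      simp only [List.map_append, List.sum_append, List.map_replicate, List.sum_replicate, hsum,
        natCast_zsmul]
      abel
    · refine ⟨J, List.replicate k x ++ J', by simp; omega, ?_⟩
      simp only [List.map_append, List.sum_append, List.map_replicate, List.sum_replicate, hsum,
        neg_smul, natCast_zsmul]
      abel

theorem List.perm_of_sum_single_eq {α : Type*} {P Q : List α}
    (h : (P.map fun x => Finsupp.single x (1 : ℤ)).sum =
      (Q.map fun x => Finsupp.single x (1 : ℤ)).sum) : P.Perm Q := by
  classical
  have key : ∀ (P : List α) (a : α),
      (P.map fun x => Finsupp.single x (1 : ℤ)).sum a = P.count a := by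
    intro P a
    induction P with
    | nil => simp
    | cons x P ih =>
      simp [ih, List.count_cons, Finsupp.single_apply, add_comm]
  refine List.perm_iff_count.2 fun a => ?_
  have := congrArg (· a) h
  simp only [key] at this
  exact_mod_cast this

/-- An integral filling of `N • x` with `L` terms exhibits `x ^ N` as a product of at most
`N + 2 * L` commutators. -/
theorem isCommutatorProduct_of_barBoundary_eq {x : G} {N : ℕ} {w : G × G →₀ ℤ}
    (hw : barBoundary ℤ w = Finsupp.single x (N : ℤ)) :
    IsCommutatorProduct (N + 2 * w.sum fun _ n => n.natAbs) (x ^ N) := by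
  obtain ⟨J, J', hlen, hsum⟩ := exists_lists_barBoundary w
  have hprod : ∀ J : List (G × G), (J.flatMap fun y => [y.1, y.2]).prod =
      (J.map fun y => y.1 * y.2).prod := by
    intro J
    induction J with
    | nil => rfl
    | cons y J ih => simp [ih, mul_assoc]
  have hchain : ∀ J : List (G × G), (J.map fun x => barBoundary ℤ (Finsupp.single x 1)).sum =
      ((J.flatMap fun y => [y.1, y.2]).map fun x => Finsupp.single x (1 : ℤ)).sum -
      ((J.map fun y => y.1 * y.2).map fun x => Finsupp.single x (1 : ℤ)).sum := by
    intro J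
    induction J with
    | nil => simp
    | cons y J ih =>
      rw [List.map_cons, List.sum_cons, ih, barBoundary_single]
      simp only [List.map_cons, List.sum_cons, List.flatMap_cons,
        List.map_append, List.sum_append, List.map_nil, List.sum_nil]
      abel
  have hlen2 : ∀ J : List (G × G), (J.flatMap fun y => [y.1, y.2]).length = 2 * J.length := by
    intro J
    induction J with
    | nil => rfl
    | cons y J ih => simp [ih]; ring
  -- With all terms moved to the side where they are positive, the boundary equation is an equality
  -- of multisets. The words for `J` and `J'` have the same products on both sides, so only `x ^ N`
  -- survives.
  have hperm : (List.replicate N x ++ ((J.map fun y => y.1 * y.2) ++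
      (J'.flatMap fun y => [y.1, y.2]))).Perm
      ((J.flatMap fun y => [y.1, y.2]) ++ (J'.map fun y => y.1 * y.2)) := by
    apply List.perm_of_sum_single_eq
    rw [hchain, hchain, hw] at hsum
    simp only [List.map_append, List.sum_append, List.map_replicate, List.sum_replicate]
    have hN : Finsupp.single x (N : ℤ) = N • Finsupp.single x (1 : ℤ) := by simp
    rw [sub_eq_iff_eq_add.1 hsum, hN]
    abel
  have := IsCommutatorProduct.prod_mul_inv_of_perm hperm
  rw [List.prod_append, List.prod_append, List.prod_append, hprod, hprod, List.prod_replicate,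
    mul_inv_cancel_right] at this
  refine this.mono ?_
  simp only [List.length_append, List.length_replicate, List.length_map, hlen2]
  omega

/-- Rational approximation of finitely many reals that preserves all rational affine relations. -/
theorem exists_rat_linear_approx (s : Finset ℝ) {η : ℝ} (hη : 0 < η) :
    ∃ f : ℝ →ₗ[ℚ] ℚ, f 1 = 1 ∧ ∀ t ∈ s, |(f t : ℝ) - t| ≤ η := by
  classical
  -- A `ℚ`-basis of `ℝ` containing `1`: the map fixes `1` and moves every other basis element to a
  -- nearby rational. As `K` bounds the `ℓ¹` norm of the coordinates of each `t ∈ s`, moving the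
  -- basis by `η / (K + 1)` moves `t` by at most `η`.
  have hli : LinearIndepOn ℚ id ({1} : Set ℝ) := LinearIndepOn.singleton (by simp)
  let b := Module.Basis.extend hli
  have h1 : (1 : ℝ) ∈ hli.extend (Set.subset_univ _) := hli.subset_extend _ (by simp)
  have hb : ∀ i, b i = i := fun i => Module.Basis.extend_apply_self hli i
  set K : ℝ := ∑ t ∈ s, (b.repr t).sum fun _ q => |(q : ℝ)| with hK
  have hK0 : 0 ≤ K := Finset.sum_nonneg fun t _ => Finset.sum_nonneg fun _ _ => abs_nonneg _
  have hδ : 0 < η / (K + 1) := by positivity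
  choose q hq using fun x : ℝ => exists_rat_near x hδ
  let v : (hli.extend (Set.subset_univ _)) → ℚ := fun i => if (i : ℝ) = 1 then 1 else q i
  have hv : ∀ i, |(v i : ℝ) - i| ≤ η / (K + 1) := by
    intro i
    by_cases hi : (i : ℝ) = 1
    · simp only [v, hi, if_true]; simp [hδ.le]
    · simp only [v, hi, if_false]
      rw [abs_sub_comm]
      exact (hq i).le
  refine ⟨b.constr ℚ v, ?_, fun t ht => ?_⟩
  · have : b.constr ℚ v (b ⟨1, h1⟩) = v ⟨1, h1⟩ := b.constr_basis ℚ v _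
    rw [hb] at this
    simpa [v] using this
  · have e1 : ((b.constr ℚ v t : ℚ) : ℝ) = (b.repr t).sum fun i r => (r : ℝ) * v i := by
      rw [Module.Basis.constr_apply]
      simp [Finsupp.sum, Rat.cast_sum]
    have e2 : t = (b.repr t).sum fun i r => (r : ℝ) * (i : ℝ) := by
      conv_lhs => rw [← b.linearCombination_repr t]
      simp [Finsupp.linearCombination_apply, hb, Rat.smul_def]
    have e3 : ((b.constr ℚ v t : ℚ) : ℝ) - t =
        (b.repr t).sum fun i r => (r : ℝ) * ((v i : ℝ) - i) := by
      calc ((b.constr ℚ v t : ℚ) : ℝ) - t = ((b.repr t).sum fun i r => (r : ℝ) * v i) -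
            (b.repr t).sum fun i r => (r : ℝ) * (i : ℝ) := by rw [e1, ← e2]
        _ = _ := by simp only [Finsupp.sum, mul_sub, Finset.sum_sub_distrib]
    rw [e3]
    calc |(b.repr t).sum fun i r => (r : ℝ) * ((v i : ℝ) - i)|
        ≤ (b.repr t).sum fun i r => |(r : ℝ)| * (η / (K + 1)) := by
          refine (Finset.abs_sum_le_sum_abs _ _).trans (Finset.sum_le_sum fun i _ => ?_)
          rw [abs_mul]
          exact mul_le_mul_of_nonneg_left (hv i) (abs_nonneg _)
      _ = ((b.repr t).sum fun _ r => |(r : ℝ)|) * (η / (K + 1)) := by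
          simp [Finsupp.sum, Finset.sum_mul]
      _ ≤ K * (η / (K + 1)) := by
          refine mul_le_mul_of_nonneg_right ?_ hδ.le
          exact Finset.single_le_sum (f := fun t => (b.repr t).sum fun _ q => |(q : ℝ)|)
            (fun t _ => Finset.sum_nonneg fun _ _ => abs_nonneg _) ht
      _ ≤ η := by
          rw [mul_div_assoc', div_le_iff₀ (by positivity)]
          nlinarith

/-- A `ℚ`-linear map `ℝ → ℚ` fixing `1` can be applied to the coefficients of a filling without
spoiling its boundary. If it is close to the identity on those coefficients, the norm hardly
changes, and denominators can then be cleared. -/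
theorem exists_integral_filling {x : G} {w : G × G →₀ ℝ}
    (hw : barBoundary ℝ w = Finsupp.single x 1) {K : ℕ} (hK : (w.sum fun _ t => |t|) < K) :
    ∃ N : ℕ, 0 < N ∧ ∃ w' : G × G →₀ ℤ, barBoundary ℤ w' = Finsupp.single x (N : ℤ) ∧
      (w'.sum fun _ n => n.natAbs) ≤ K * N := by
  classical
  -- The slack in the norm is shared among the terms of the support; the added `1` keeps the
  -- denominator positive.
  set η : ℝ := (K - w.sum fun _ t => |t|) / (w.support.card + 1) with hη
  have hη0 : 0 < η := div_pos (sub_pos.2 hK) (by positivity)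
  obtain ⟨f, hf1, hf⟩ := exists_rat_linear_approx (w.support.image w) hη0
  set v : G × G →₀ ℚ := Finsupp.mapRange.addMonoidHom f.toAddMonoidHom w with hv
  have hvb : barBoundary ℚ v = Finsupp.single x 1 := by
    rw [hv, barBoundary_mapRange, hw]
    simp [hf1]
  have hvn : (w.support.sum fun y => |v y|) ≤ K := by
    have h1 : ∀ y ∈ w.support, ((|v y| : ℚ) : ℝ) ≤ |w y| + η := fun y hy => by
      have := hf (w y) (Finset.mem_image_of_mem _ hy)
      have h2 : v y = f (w y) := by simp [hv]
      rw [h2, Rat.cast_abs]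
      linarith [abs_sub_abs_le_abs_sub (f (w y) : ℝ) (w y)]
    have h2 : (((w.support.sum fun y => |v y|) : ℚ) : ℝ) ≤ K := by
      rw [Rat.cast_sum]
      refine (Finset.sum_le_sum h1).trans ?_
      rw [Finset.sum_add_distrib, Finset.sum_const, nsmul_eq_mul]
      have h3 : (w.support.card : ℝ) * η ≤ K - w.sum fun _ t => |t| := by
        rw [hη, mul_div_assoc', div_le_iff₀ (by positivity)]
        nlinarith [sub_pos.2 hK]
      have h4 : (w.sum fun _ t => |t|) = w.support.sum fun y => |w y| := rfl
      linarith
    exact_mod_cast h2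
  set N : ℕ := ∏ y ∈ w.support, (v y).den with hN
  have hN0 : 0 < N := Finset.prod_pos fun y _ => (v y).den_pos
  let w' : G × G →₀ ℤ := v.mapRange (fun q : ℚ => ((N : ℚ) * q).num) (by simp)
  have hw' : ∀ y, ((w' y : ℤ) : ℚ) = N * v y := by
    intro y
    have hden : (v y).den ∣ N := by
      by_cases hy : y ∈ w.support
      · exact Finset.dvd_prod_of_mem _ hy
      · have : v y = 0 := by simp [hv, Finsupp.notMem_support_iff.1 hy]
        simp [this]
    obtain ⟨k, hk⟩ := hden
    have : (N : ℚ) * v y = ((k * (v y).num : ℤ) : ℚ) := by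
      push_cast
      rw [hk]
      push_cast
      rw [mul_comm ((v y).den : ℚ), mul_assoc, Rat.den_mul_eq_num]
    simp only [w', Finsupp.mapRange_apply]
    rw [this, Rat.num_intCast]
  have hcast : Finsupp.mapRange.addMonoidHom (Int.castAddHom ℚ) w' = (N : ℚ) • v := by
    ext y
    simpa using hw' y
  refine ⟨N, hN0, w', ?_, ?_⟩
  · have hinj : Function.Injective
        (Finsupp.mapRange.addMonoidHom (Int.castAddHom ℚ) : (G →₀ ℤ) →+ (G →₀ ℚ)) :=
      Finsupp.mapRange_injective _ (map_zero _) Int.cast_injective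
    apply hinj
    rw [← barBoundary_mapRange, hcast, map_smul, hvb]
    simp
  · have hsub : w'.support ⊆ w.support := by
      intro y hy
      by_contra hy'
      have : v y = 0 := by simp [hv, Finsupp.notMem_support_iff.1 hy']
      exact Finsupp.mem_support_iff.1 hy (by simp [w', this])
    have h1 : (((w'.sum fun _ n => n.natAbs) : ℕ) : ℚ) ≤ K * N := by
      rw [Finsupp.sum_of_support_subset _ hsub _ (by simp), Nat.cast_sum]
      calc ∑ y ∈ w.support, (((w' y).natAbs : ℕ) : ℚ) = ∑ y ∈ w.support, N * |v y| := by
            refine Finset.sum_congr rfl fun y _ => ?_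
            rw [Nat.cast_natAbs, Int.cast_abs, hw', abs_mul, Nat.abs_cast]
        _ = N * ∑ y ∈ w.support, |v y| := by rw [Finset.mul_sum]
        _ ≤ N * K := mul_le_mul_of_nonneg_left hvn (by positivity)
        _ = K * N := mul_comm _ _
    exact_mod_cast h1

theorem apply_barBoundary_single (F : (G →₀ ℝ) →ₗ[ℝ] ℝ) (a b : G) :
    F (barBoundary ℝ (Finsupp.single (a, b) 1)) =
      F (Finsupp.single a 1) + F (Finsupp.single b 1) - F (Finsupp.single (a * b) 1) := by
  rw [barBoundary_single]
  simp

/-- If no homomorphism to `ℝ` detects `x`, then `x` bounds a real chain. -/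
theorem exists_real_filling {x : G} (hx : ∀ χ : Additive G →+ ℝ, χ (Additive.ofMul x) = 0) :
    ∃ w, barBoundary ℝ w = Finsupp.single x 1 := by
  by_contra hcon
  -- A functional that kills all boundaries is additive on group elements; not killing `x`, it is a
  -- homomorphism that detects `x`.
  obtain ⟨F, hFx, hF⟩ := Submodule.exists_le_ker_of_notMem (p := LinearMap.range (barBoundary ℝ))
    (v := Finsupp.single x (1 : ℝ)) (fun ⟨w, hw⟩ => hcon ⟨w, hw⟩)
  have hadd : ∀ a b : G, F (Finsupp.single (a * b) 1) =
      F (Finsupp.single a 1) + F (Finsupp.single b 1) := fun a b => by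
    have h := apply_barBoundary_single F a b
    rw [LinearMap.mem_ker.1 (hF ⟨_, rfl⟩)] at h
    linarith
  exact hFx (hx (AddMonoidHom.mk' (fun g => F (Finsupp.single g.toMul 1)) fun a b => hadd _ _))

/-- A group element without real filling of norm less than `K` is detected by a quasimorphism of
defect at most one. -/
theorem exists_quasimorphism_of_filling {x : G} {K : ℝ} (hK : 0 < K)
    {w₀ : G × G →₀ ℝ} (hw₀ : barBoundary ℝ w₀ = Finsupp.single x 1)
    (h : ∀ w : G × G →₀ ℝ, barBoundary ℝ w = Finsupp.single x 1 → K ≤ w.sum fun _ t => |t|) :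
    ∃ f : G → ℝ, (∀ a b, |f (a * b) - f a - f b| ≤ 1) ∧ f x = K := by
  classical
  let norm : (G × G →₀ ℝ) → ℝ := fun w => w.sum fun _ t => |t|
  have hnorm_smul : ∀ (c : ℝ) (w), norm (c • w) = |c| * norm w := fun c w => by
    simp only [norm]
    rw [Finsupp.sum_smul_index (by simp), Finsupp.mul_sum]
    simp [abs_mul]
  have hnorm_add : ∀ u v, norm (u + v) ≤ norm u + norm v := fun u v => by
    simp only [norm]
    rw [Finsupp.sum_of_support_subset (u + v) Finsupp.support_add _ (by simp),
      Finsupp.sum_of_support_subset u Finset.subset_union_left _ (by simp),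
      Finsupp.sum_of_support_subset v Finset.subset_union_right _ (by simp),
      ← Finset.sum_add_distrib]
    exact Finset.sum_le_sum fun y _ => abs_add_le _ _
  have hker : w₀ ∉ (⟨LinearMap.ker (barBoundary ℝ), 0⟩ : (G × G →₀ ℝ) →ₗ.[ℝ] ℝ).domain := by
    intro hmem
    have := LinearMap.mem_ker.1 hmem
    rw [hw₀] at this
    simp at this
  -- The functional is `0` on cycles and `K` on `w₀`. The lower bound for the norm of fillings says
  -- exactly that the `ℓ¹` norm dominates it, so Hahn-Banach applies.
  let p := LinearPMap.supSpanSingleton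
    (⟨LinearMap.ker (barBoundary ℝ), 0⟩ : (G × G →₀ ℝ) →ₗ.[ℝ] ℝ) w₀ K hker
  obtain ⟨F, hFp, hF⟩ := exists_extension_of_le_sublinear p norm
    (fun c hc w => by rw [hnorm_smul, abs_of_pos hc]) hnorm_add (by
      rintro ⟨v, hv⟩
      obtain ⟨u, hu, y, hy, rfl⟩ := Submodule.mem_sup.1 hv
      obtain ⟨c, rfl⟩ := Submodule.mem_span_singleton.1 hy
      have : p ⟨u + c • w₀, hv⟩ = c * K := by
        have h := LinearPMap.supSpanSingleton_apply_mk
          (⟨LinearMap.ker (barBoundary ℝ), 0⟩ : (G × G →₀ ℝ) →ₗ.[ℝ] ℝ) w₀ K hker u hu c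
        refine h.trans ?_
        simp
      rw [this]
      change c * K ≤ norm (u + c • w₀)
      rcases eq_or_ne c 0 with rfl | hc
      · rw [zero_mul]
        exact Finset.sum_nonneg fun _ _ => abs_nonneg _
      · have h1 : K ≤ norm (c⁻¹ • (u + c • w₀)) := by
          apply h
          rw [map_smul, map_add, LinearMap.mem_ker.1 hu, map_smul, hw₀, zero_add, smul_smul,
            inv_mul_cancel₀ hc, one_smul]
        rw [hnorm_smul, abs_inv, inv_mul_eq_div, le_div_iff₀ (abs_pos.2 hc), mul_comm] at h1
        exact (mul_le_mul_of_nonneg_right (le_abs_self c) hK.le).trans h1)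
  have hF0 : LinearMap.ker (barBoundary ℝ) ≤ LinearMap.ker F := fun u hu => by
    have h1 := hFp ⟨u, Submodule.mem_sup_left hu⟩
    refine LinearMap.mem_ker.2 (h1.trans ?_)
    exact LinearPMap.supSpanSingleton_apply_mk_of_mem _ K hker hu
  have hFw : F w₀ = K := by
    refine (hFp ⟨w₀, Submodule.mem_sup_right (Submodule.mem_span_singleton_self _)⟩).trans ?_
    exact LinearPMap.supSpanSingleton_apply_self _ K hker
  -- Since `F` kills cycles, it is `f ∘ ∂`. Its values on basis chains, which have norm `1`, are the
  -- deviations of `f` from additivity.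
  obtain ⟨f, rfl⟩ : F ∈ LinearMap.range (barBoundary ℝ : (G × G →₀ ℝ) →ₗ[ℝ] _).dualMap := by
    rw [LinearMap.range_dualMap_eq_dualAnnihilator_ker, Submodule.mem_dualAnnihilator]
    exact hF0
  refine ⟨fun g => f (Finsupp.single g 1), fun a b => ?_, ?_⟩
  · have h1 := hF (Finsupp.single (a, b) 1)
    have h2 := hF (-Finsupp.single (a, b) 1)
    have n1 : norm (Finsupp.single (a, b) 1) = 1 := by simp [norm]
    have n2 : norm (-Finsupp.single (a, b) 1) = 1 := by
      rw [← neg_one_smul ℝ, hnorm_smul, n1]; simp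
    rw [map_neg, n2] at h2
    rw [n1] at h1
    rw [LinearMap.dualMap_apply, apply_barBoundary_single] at h1 h2
    rw [abs_le]
    constructor <;> linarith
  · rw [← hFw, LinearMap.dualMap_apply, hw₀]

theorem abs_pow_sub_le {f : G → ℝ} (hf : ∀ a b, |f (a * b) - f a - f b| ≤ 1) (x : G) (n : ℕ) :
    |f (x ^ (n + 1)) - (n + 1) * f x| ≤ n := by
  induction n with
  | zero => simp
  | succ n ih =>
    have h := hf (x ^ (n + 1)) x
    rw [pow_succ _ (n + 1)]
    rw [abs_le] at *
    push_cast
    constructor <;> linarith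

/-- If every quasimorphism is bounded on the powers of `h`, then the commutator length of
`h ^ n` grows sublinearly along a subsequence. -/
theorem exists_isCommutatorProduct_pow {h : G}
    (hhom : ∀ χ : Additive G →+ ℝ, χ (Additive.ofMul h) = 0)
    (hqm : ∀ f : G → ℝ, (∀ a b, |f (a * b) - f a - f b| ≤ 1) → ∃ C : ℝ, ∀ n : ℕ, |f (h ^ n)| ≤ C)
    (n : ℕ) : ∃ N : ℕ, 0 < N ∧ IsCommutatorProduct (7 * N) (h ^ (n * N)) := by
  -- Otherwise some `f` of defect at most `1` takes the value `3` on `h ^ n`, so it is at least `3 *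
  -- (k + 1) - k` on `h ^ (n * (k + 1))`, hence unbounded on powers. Any threshold above the defect
  -- would do.
  have hfill : ∃ w : G × G →₀ ℝ, barBoundary ℝ w = Finsupp.single (h ^ n) 1 ∧
      (w.sum fun _ t => |t|) < (3 : ℕ) := by
    by_contra! hcon
    obtain ⟨w₀, hw₀⟩ := exists_real_filling (x := h ^ n) fun χ => by
      rw [ofMul_pow, map_nsmul, hhom, smul_zero]
    obtain ⟨f, hf, hfx⟩ := exists_quasimorphism_of_filling (by norm_num) hw₀ hcon
    obtain ⟨C, hC⟩ := hqm f hf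
    obtain ⟨k, hk⟩ := exists_nat_gt C
    have h1 := abs_pow_sub_le hf (h ^ n) k
    have h2 := hC (n * (k + 1))
    rw [pow_mul] at h2
    rw [hfx] at h1
    rw [abs_le] at h1 h2
    push_cast at h1
    linarith
  obtain ⟨w, hw, hlt⟩ := hfill
  obtain ⟨N, hN, w', hw', hle⟩ := exists_integral_filling hw hlt
  refine ⟨N, hN, ?_⟩
  rw [pow_mul]
  -- The constant is `7 = 1 + 2 * 3`.
  exact (isCommutatorProduct_of_barBoundary_eq hw').mono (by omega)
end Fillings

/-! ### Finite presentability of products and central extensions. -/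

section FinitePresentation

open scoped commutatorElement

variable {G H : Type*} [Group G] [Group H]

theorem Group.IsFinitelyPresented.group_fg (h : Group.IsFinitelyPresented G) : Group.FG G := by
  obtain ⟨n, f, hf, -⟩ := h.out
  exact Group.fg_of_surjective hf

/-- The product is the free product modulo the commutators of the generators of the two factors:
commuting spreads from generators to all elements, one factor at a time. -/
theorem Group.IsFinitelyPresented.prod (hG : Group.IsFinitelyPresented G)
    (hH : Group.IsFinitelyPresented H) : Group.IsFinitelyPresented (G × H) := by
  obtain ⟨S, hS, hSfin⟩ := Group.fg_iff.1 hG.group_fg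
  obtain ⟨T, hT, hTfin⟩ := Group.fg_iff.1 hH.group_fg
  refine Group.IsFinitelyPresented.of_surjective (G := Monoid.Coprod G H) Monoid.Coprod.toProd
    Monoid.Coprod.toProd_surjective
    ⟨(fun x : G × H => ⁅(Monoid.Coprod.inl x.1 : Monoid.Coprod G H), Monoid.Coprod.inr x.2⁆) ''
      (S ×ˢ T), (hSfin.prod hTfin).image _, le_antisymm ?_ ?_⟩
  · refine Subgroup.normalClosure_le_normal ?_
    rintro _ ⟨⟨x, y⟩, -, rfl⟩
    simp [MonoidHom.mem_ker, commutatorElement_def]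
  · set N := Subgroup.normalClosure
      ((fun x : G × H => ⁅(Monoid.Coprod.inl x.1 : Monoid.Coprod G H),
        (Monoid.Coprod.inr x.2 : Monoid.Coprod G H)⁆) '' (S ×ˢ T)) with hN
    let i : G →* Monoid.Coprod G H ⧸ N := (QuotientGroup.mk' N).comp Monoid.Coprod.inl
    let j : H →* Monoid.Coprod G H ⧸ N := (QuotientGroup.mk' N).comp Monoid.Coprod.inr
    have hST : ∀ x ∈ S, ∀ y ∈ T, Commute (i x) (j y) := by
      intro x hx y hy
      rw [← commutatorElement_eq_one_iff_commute]
      change ⁅QuotientGroup.mk' N _, QuotientGroup.mk' N _⁆ = 1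
      rw [← map_commutatorElement]
      exact (QuotientGroup.eq_one_iff _).2 (Subgroup.subset_normalClosure ⟨(x, y), ⟨hx, hy⟩, rfl⟩)
    have hT' : ∀ x ∈ S, ∀ y, Commute (i x) (j y) := by
      intro x hx y
      have hy : y ∈ Subgroup.closure T := hT ▸ Subgroup.mem_top y
      induction hy using Subgroup.closure_induction with
      | mem y hy => exact hST x hx y hy
      | one => rw [map_one]; exact Commute.one_right _
      | mul a b _ _ ha hb => rw [map_mul]; exact ha.mul_right hb
      | inv a _ ha => rw [map_inv]; exact ha.inv_right
    have hall : ∀ x y, Commute (i x) (j y) := by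
      intro x y
      have hx : x ∈ Subgroup.closure S := hS ▸ Subgroup.mem_top x
      induction hx using Subgroup.closure_induction with
      | mem x hx => exact hT' x hx y
      | one => rw [map_one]; exact Commute.one_left _
      | mul a b _ _ ha hb => rw [map_mul]; exact ha.mul_left hb
      | inv a _ ha => rw [map_inv]; exact ha.inv_left
    -- The quotient map by `N` factors through `G × H`, so `N` contains the kernel of `toProd`.
    have hcomp : (MonoidHom.noncommCoprod i j hall).comp Monoid.Coprod.toProd =
        QuotientGroup.mk' N := by
      ext x <;> simp [i, j]
    intro x hx
    rw [← QuotientGroup.ker_mk' N, ← hcomp, MonoidHom.mem_ker, MonoidHom.comp_apply,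
      MonoidHom.mem_ker.1 hx, map_one]

theorem isFinitelyPresented_multiplicative_fin_int (n : ℕ) :
    Group.IsFinitelyPresented (Multiplicative (Fin n → ℤ)) := by
  induction n with
  | zero => infer_instance
  | succ n ih =>
    have := Group.IsFinitelyPresented.prod (inferInstance :
      Group.IsFinitelyPresented (Multiplicative ℤ)) ih
    exact Group.IsFinitelyPresented.equiv
      ((MulEquiv.prodMultiplicative ℤ (Fin n → ℤ)).symm.trans
        (AddEquiv.toMultiplicative (Fin.consLinearEquiv ℤ (fun _ : Fin (n + 1) => ℤ)).toAddEquiv))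

theorem isFinitelyPresented_multiplicative_of_finite (A : Type*) [AddCommGroup A]
    [Module ℤ A] [Module.Finite ℤ A] : Group.IsFinitelyPresented (Multiplicative A) := by
  obtain ⟨n, f, hf⟩ := Module.Finite.exists_fin' ℤ A
  have := isFinitelyPresented_multiplicative_fin_int n
  refine Group.IsFinitelyPresented.of_surjective (G := Multiplicative (Fin n → ℤ))
    (AddMonoidHom.toMultiplicative f.toAddMonoidHom) (fun x => hf x) ?_
  obtain ⟨S, hS⟩ := (IsNoetherian.noetherian (LinearMap.ker f) : (LinearMap.ker f).FG)
  refine ⟨Multiplicative.toAdd ⁻¹' (S : Set (Fin n → ℤ)),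
    S.finite_toSet.preimage Multiplicative.toAdd.injective.injOn, le_antisymm ?_ ?_⟩
  · refine Subgroup.normalClosure_le_normal fun x hx => ?_
    have : Multiplicative.toAdd x ∈ LinearMap.ker f := hS ▸ Submodule.subset_span hx
    have hfx : f (Multiplicative.toAdd x) = 0 := LinearMap.mem_ker.1 this
    exact hfx
  · intro x hx
    have hx' : Multiplicative.toAdd x ∈ Submodule.span ℤ (S : Set (Fin n → ℤ)) :=
      hS ▸ LinearMap.mem_ker.2 hx
    have key : ∀ y ∈ Submodule.span ℤ (S : Set (Fin n → ℤ)), Multiplicative.ofAdd y ∈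
        Subgroup.normalClosure (Multiplicative.toAdd ⁻¹' (S : Set (Fin n → ℤ))) := by
      intro y hy
      induction hy using Submodule.span_induction with
      | mem y hy => exact Subgroup.subset_normalClosure hy
      | zero => exact one_mem _
      | add a b _ _ ha hb => exact mul_mem ha hb
      | smul k a _ ha => exact zpow_mem ha k
    exact key _ hx'

/-- A central extension of a finitely presented group by a finitely presented group is finitely
presented. -/
theorem Group.IsFinitelyPresented.of_central_extension {A E : Type*} [Group A] [Group E]
    (i : A →* E) (p : E →* G) (hp : Function.Surjective p) (hip : i.range = p.ker)
    (hi : i.range ≤ Subgroup.center E) (hA : Group.IsFinitelyPresented A)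
    (hi_inj : Function.Injective i)
    (hG : Group.IsFinitelyPresented G) : Group.IsFinitelyPresented E := by
  obtain ⟨n, π, hπ, R, hRfin, hR⟩ := hG.out
  let l : FreeGroup (Fin n) →* E := FreeGroup.lift fun k => Function.surjInv hp (π (FreeGroup.of k))
  have hl : p.comp l = π := by
    ext k
    simp [l, Function.surjInv_eq]
  have hcomm : ∀ w a, Commute (l w) (i a) := fun w a =>
    Subgroup.mem_center_iff.1 (hi ⟨a, rfl⟩) (l w)
  -- `E` is a quotient of `F × A`, and each relator `r` of `G` is corrected by the element of `A`
  -- that corresponds to `(l r)⁻¹`.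
  let f : FreeGroup (Fin n) × A →* E := MonoidHom.noncommCoprod l i hcomm
  have hmem : ∀ r ∈ π.ker, ∃ a, i a = (l r)⁻¹ := fun r hr => by
    change (l r)⁻¹ ∈ i.range
    rw [hip, MonoidHom.mem_ker, map_inv, ← MonoidHom.comp_apply, hl, MonoidHom.mem_ker.1 hr,
      inv_one]
  have : Group.IsFinitelyPresented (FreeGroup (Fin n) × A) :=
    Group.IsFinitelyPresented.prod inferInstance hA
  refine Group.IsFinitelyPresented.of_surjective f ?_ ?_
  · intro e
    obtain ⟨w, hw⟩ := hπ (p e)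
    have : (l w)⁻¹ * e ∈ i.range := by
      rw [hip, MonoidHom.mem_ker, map_mul, map_inv, ← MonoidHom.comp_apply, hl, hw,
        inv_mul_cancel]
    obtain ⟨a, ha⟩ := this
    exact ⟨(w, a), by simp [f, ha]⟩
  · have hRker : ∀ r ∈ R, r ∈ π.ker := fun r hr => hR ▸ Subgroup.subset_normalClosure hr
    choose! g hg using hmem
    refine ⟨(fun r => (r, g r)) '' R, hRfin.image _, le_antisymm ?_ ?_⟩
    · refine Subgroup.normalClosure_le_normal ?_
      rintro _ ⟨r, hr, rfl⟩
      simp [f, MonoidHom.mem_ker, hg r (hRker r hr)]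
    · set N := Subgroup.normalClosure ((fun r => (r, g r)) '' R) with hN
      -- The projection of `N` to the free group contains all relations. The second coordinate is
      -- not controlled by this, but as `N ≤ f.ker` and `i` is injective, it is forced.
      have key : ∀ r ∈ π.ker, ∃ a, i a = (l r)⁻¹ ∧ (r, a) ∈ N := by
        intro r hr
        rw [← hR] at hr
        have hc : Subgroup.normalClosure R ≤
            (N.map (MonoidHom.fst (FreeGroup (Fin n)) A)) := by
          have : (N.map (MonoidHom.fst (FreeGroup (Fin n)) A)).Normal :=
            Subgroup.Normal.map inferInstance _ Prod.fst_surjective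
          refine Subgroup.normalClosure_le_normal fun r hr => ?_
          exact ⟨(r, g r), Subgroup.subset_normalClosure ⟨r, hr, rfl⟩, rfl⟩
        obtain ⟨⟨r', a⟩, hra, rfl⟩ := hc hr
        refine ⟨a, ?_, hra⟩
        have : N ≤ f.ker := by
          refine Subgroup.normalClosure_le_normal ?_
          rintro _ ⟨r, hr, rfl⟩
          simp [f, MonoidHom.mem_ker, hg r (hRker r hr)]
        have h1 := MonoidHom.mem_ker.1 (this hra)
        simp only [f, MonoidHom.noncommCoprod_apply] at h1
        exact (inv_eq_of_mul_eq_one_right h1).symm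
      rintro ⟨w, a⟩ hwa
      have h1 : l w * i a = 1 := by simpa [f] using MonoidHom.mem_ker.1 hwa
      have hw : w ∈ π.ker := by
        have h2 := congrArg p h1
        have h3 : p (i a) = 1 := MonoidHom.mem_ker.1 (hip ▸ ⟨a, rfl⟩)
        rw [map_mul, h3, mul_one, map_one, ← MonoidHom.comp_apply, hl] at h2
        exact MonoidHom.mem_ker.2 h2
      obtain ⟨a', ha', hN'⟩ := key w hw
      have : a' = a := hi_inj (ha'.trans (inv_eq_of_mul_eq_one_right h1))
      exact this ▸ hN'

end FinitePresentation

/-! ### Universal coefficients in degree two. -/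

section UniversalCoefficients

/-- Submodules of (not necessarily finitely generated) free abelian groups are free. -/
theorem Submodule.free_of_finsupp_int {ι : Type*} (N : Submodule ℤ (ι →₀ ℤ)) :
    Module.Free ℤ N := by
  classical
  -- With respect to a well-order, `I i` is the ideal of leading coefficients at `i` of elements of
  -- `N`, and `b i` realises its generator. The `b i` with nonzero generator form a basis.
  obtain ⟨_, hwf⟩ := exists_wellFoundedLT ι
  let I : ι → Submodule ℤ ℤ := fun i =>
    (N ⊓ Finsupp.supported ℤ ℤ (Set.Iic i)).map (Finsupp.lapply i)
  let n : ι → ℤ := fun i => Submodule.IsPrincipal.generator (I i)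
  have hn : ∀ i, ∃ b ∈ N ⊓ Finsupp.supported ℤ ℤ (Set.Iic i), b i = n i := fun i =>
    Submodule.mem_map.1 (Submodule.IsPrincipal.generator_mem (I i))
  choose b hb hbn using hn
  have hb0 : ∀ i j, i < j → b i j = 0 := fun i j hij => by
    by_contra h
    exact absurd ((Finsupp.mem_supported ℤ _).1 (hb i).2 (Finsupp.mem_support_iff.2 h))
      (not_le.2 hij)
  let v : {i // n i ≠ 0} → N := fun i => ⟨b i, (hb i).1⟩
  have hli : LinearIndependent ℤ v := by
    rw [linearIndependent_iff]
    intro l hl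
    by_contra hne
    have hsupp : l.support.Nonempty := Finsupp.support_nonempty_iff.2 hne
    -- At the largest index of the support only one term of the relation survives.
    let j := l.support.max' hsupp
    have hj : j ∈ l.support := Finset.max'_mem _ _
    have h1 := congrArg (fun x : N => (x : ι →₀ ℤ) j) hl
    simp only [Finsupp.linearCombination_apply, Finsupp.sum, v, Submodule.coe_sum,
      Submodule.coe_smul, Finsupp.finsetSum_apply, Finsupp.smul_apply, smul_eq_mul,
      Submodule.coe_zero, Finsupp.zero_apply] at h1
    rw [Finset.sum_eq_single j] at h1
    · rcases mul_eq_zero.1 h1 with h | h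
      · exact Finsupp.mem_support_iff.1 hj h
      · rw [hbn] at h
        exact j.2 h
    · intro i hi hij
      have : i < j := lt_of_le_of_ne (Finset.le_max' _ _ hi) hij
      rw [hb0 i j this, mul_zero]
    · intro h
      exact absurd hj h
  have hspan : ∀ i, ∀ x : N, (x : ι →₀ ℤ) ∈ Finsupp.supported ℤ ℤ (Set.Iic i) →
      x ∈ Submodule.span ℤ (Set.range v) := by
    intro i
    induction i using hwf.induction with
    | _ i ih =>
      have hlower : ∀ y : N, (y : ι →₀ ℤ) ∈ Finsupp.supported ℤ ℤ (Set.Iic i) →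
          (y : ι →₀ ℤ) i = 0 → y ∈ Submodule.span ℤ (Set.range v) := by
        intro y hy hyi
        by_cases h0 : y = 0
        · rw [h0]; exact zero_mem _
        have hs : (y : ι →₀ ℤ).support.Nonempty :=
          Finsupp.support_nonempty_iff.2 fun h => h0 (Subtype.ext h)
        refine ih ((y : ι →₀ ℤ).support.max' hs) ?_ y ?_
        · have hm := Finset.max'_mem _ hs
          refine lt_of_le_of_ne ((Finsupp.mem_supported ℤ _).1 hy hm) fun h => ?_
          rw [h] at hm
          exact Finsupp.mem_support_iff.1 hm hyi
        · exact (Finsupp.mem_supported ℤ _).2 fun k hk => Finset.le_max' _ _ hk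
      intro x hx
      have hxi : (x : ι →₀ ℤ) i ∈ I i := Submodule.mem_map.2 ⟨x, ⟨x.2, hx⟩, rfl⟩
      obtain ⟨k, hk⟩ := (Submodule.IsPrincipal.mem_iff_eq_smul_generator (I i)).1 hxi
      by_cases hni : n i = 0
      · refine hlower x hx ?_
        rw [hk]
        change k • n i = 0
        rw [hni, smul_zero]
      · have hy := hlower (x - k • v ⟨i, hni⟩)
          (Submodule.sub_mem _ hx (Submodule.smul_mem _ k (hb i).2)) (by
            simp only [v, Submodule.coe_sub, Submodule.coe_smul, Finsupp.sub_apply,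
              Finsupp.smul_apply, hbn, hk]
            exact sub_self _)
        have := Submodule.add_mem _ hy
          (Submodule.smul_mem _ k (Submodule.subset_span ⟨⟨i, hni⟩, rfl⟩))
        simpa using this
  refine Module.Free.of_basis (Module.Basis.mk hli fun x _ => ?_)
  by_cases h0 : x = 0
  · rw [h0]; exact zero_mem _
  have hs : (x : ι →₀ ℤ).support.Nonempty :=
    Finsupp.support_nonempty_iff.2 fun h => h0 (Subtype.ext h)
  exact hspan ((x : ι →₀ ℤ).support.max' hs) x ((Finsupp.mem_supported ℤ _).2 fun k hk => Finset.le_max' _ _ hk)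

variable {G : Type} [Group G]

/-- The boundary map `C₂(G; ℤ) → C₁(G; ℤ)`. -/
noncomputable abbrev intBoundary (G : Type) [Group G] : (G × G →₀ ℤ) →ₗ[ℤ] (G →₀ ℤ) :=
  (groupHomology.d₂₁ (Rep.trivial ℤ G ℤ)).hom

theorem intBoundary_single (x : G × G) (n : ℤ) : intBoundary G (Finsupp.single x n) =
    Finsupp.single x.2 n - Finsupp.single (x.1 * x.2) n + Finsupp.single x.1 n := by
  erw [groupHomology.d₂₁_single]
  rfl

/-- The image of the boundary map is free as a subgroup of a free abelian group, so the cycles are a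
direct summand of the chains. A homomorphism on cycles thus extends along a retraction `r`, and it
is a cocycle because it kills boundaries. -/
theorem exists_cocycle_kronecker_eq {A : ModuleCat.{0} ℤ}
    (f : trivialHomology ℤ G 2 →ₗ[ℤ] A) :
    ∃ c : groupCohomology.cocycles₂ (Rep.trivial ℤ G A),
      kronecker ((groupCohomology.H2π (Rep.trivial ℤ G A)).hom c) = f := by
  have := Submodule.free_of_finsupp_int (LinearMap.range (intBoundary G))
  obtain ⟨s, hs⟩ := Module.projective_lifting_property (intBoundary G).rangeRestrict
    LinearMap.id (intBoundary G).surjective_rangeRestrict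
  let r : (G × G →₀ ℤ) →ₗ[ℤ] groupHomology.cycles₂ (Rep.trivial ℤ G ℤ) :=
    LinearMap.codRestrict _ (LinearMap.id - s ∘ₗ (intBoundary G).rangeRestrict) fun x => by
      have h := congrArg Subtype.val (LinearMap.congr_fun hs ((intBoundary G).rangeRestrict x))
      refine LinearMap.mem_ker.2 ?_
      change intBoundary G (x - s ((intBoundary G).rangeRestrict x)) = 0
      rw [map_sub]
      exact sub_eq_zero.2 h.symm
  have hr : ∀ z : groupHomology.cycles₂ (Rep.trivial ℤ G ℤ), r z.1 = z := fun z => by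
    refine Subtype.ext ?_
    have hz : (intBoundary G).rangeRestrict z.1 = 0 := Subtype.ext (LinearMap.mem_ker.1 z.2)
    change z.1 - s ((intBoundary G).rangeRestrict z.1) = z.1
    rw [hz, map_zero, sub_zero]
  let F : (G × G →₀ ℤ) →ₗ[ℤ] A :=
    f ∘ₗ (groupHomology.H2π (Rep.trivial ℤ G ℤ)).hom ∘ₗ r
  have hF : ∀ z : groupHomology.cycles₂ (Rep.trivial ℤ G ℤ),
      F z.1 = f ((groupHomology.H2π (Rep.trivial ℤ G ℤ)).hom z) := fun z => by
    simp only [F, LinearMap.comp_apply, hr]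
  have hFc : ∀ w, Finsupp.linearCombination ℤ (fun x : G × G => F (Finsupp.single x 1)) w = F w := by
    intro w
    induction w using Finsupp.induction_linear with
    | zero => simp
    | add u v hu hv => rw [map_add, map_add, hu, hv]
    | single x n => 
      rw [Finsupp.linearCombination_single]
      exact (F.map_smul n _).symm.trans (by rw [Finsupp.smul_single_one])
  have hcoc : ∀ g h j : G, F (Finsupp.single (g * h, j) 1) + F (Finsupp.single (g, h) 1) =
      F (Finsupp.single (h, j) 1) + F (Finsupp.single (g, h * j) 1) := by
    intro g h j
    let z : G × G →₀ ℤ := (groupHomology.d₃₂ (Rep.trivial ℤ G ℤ)).hom (Finsupp.single (g, h, j) 1)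
    have hz : z = Finsupp.single (h, j) 1 - Finsupp.single (g * h, j) 1 +
        Finsupp.single (g, h * j) 1 - Finsupp.single (g, h) 1 :=
      groupHomology.d₃₂_single _ _
    have hzb : z ∈ groupHomology.boundaries₂ (Rep.trivial ℤ G ℤ) := ⟨_, rfl⟩
    have hz0 : F z = 0 := by
      have h1 := hF ⟨z, groupHomology.boundaries₂_le_cycles₂ _ hzb⟩
      have h2 := (groupHomology.H2π_eq_zero_iff (A := Rep.trivial ℤ G ℤ)
        ⟨z, groupHomology.boundaries₂_le_cycles₂ _ hzb⟩).2 hzb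
      exact h1.trans ((congrArg f h2).trans (map_zero f))
    rw [hz, map_sub, map_add, map_sub] at hz0
    rw [← sub_eq_zero, ← neg_eq_zero, ← hz0]
    abel
  refine ⟨⟨fun x => F (Finsupp.single x 1), (groupCohomology.mem_cocycles₂_iff _).2 hcoc⟩, ?_⟩
  ext y
  obtain ⟨z, rfl⟩ := groupHomology_H2π_surjective _ y
  exact (kronecker_H2π _ z).trans ((hFc z.1).trans (hF z))

/-- A real 2-cochain that vanishes on all integral cycles is a coboundary. -/
theorem exists_coboundary_of_vanishing (c : G × G → ℝ)
    (hc : ∀ z : groupHomology.cycles₂ (Rep.trivial ℤ G ℤ),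
      Finsupp.linearCombination ℤ c z.1 = 0) :
    ∃ f : G → ℝ, ∀ g h, c (g, h) = f h - f (g * h) + f g := by
  let L : (G × G →₀ ℤ) →ₗ[ℤ] ℝ := Finsupp.linearCombination ℤ c
  have hker : LinearMap.ker (intBoundary G) ≤ LinearMap.ker L := fun z hz =>
    LinearMap.mem_ker.2 (hc ⟨z, hz⟩)
  let M : LinearMap.range (intBoundary G) →ₗ[ℤ] ℝ :=
    (intBoundary G).rangeRestrict.descend (intBoundary G).surjective_rangeRestrict L
      (by rwa [LinearMap.ker_rangeRestrict])
  -- The functional `M` induced on boundaries extends to all 1-chains because `ℝ` is divisible.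
  obtain ⟨f, hf⟩ := (Module.Baer.of_divisible ℝ).extension_property
    (LinearMap.range (intBoundary G)).subtype (Submodule.injective_subtype _) M
  refine ⟨fun g => f (Finsupp.single g 1), fun g h => ?_⟩
  have h1 : L (Finsupp.single (g, h) 1) = f (intBoundary G (Finsupp.single (g, h) 1)) := by
    have h2 := LinearMap.congr_fun hf ((intBoundary G).rangeRestrict (Finsupp.single (g, h) 1))
    refine Eq.trans ?_ h2.symm
    exact (LinearMap.descend_apply _ _ _ _ _).symm
  rw [intBoundary_single] at h1
  simpa [L] using h1

end UniversalCoefficients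

/-! ### The central extension defined by a cocycle. -/

section CocycleExtension

variable {G A : Type*} [Group G] [AddCommGroup A]

/-- The 2-cocycle condition for trivial coefficients. -/
def IsTrivialCocycle (c : G × G → A) : Prop :=
  ∀ g h j, c (g * h, j) + c (g, h) = c (h, j) + c (g, h * j)

theorem IsTrivialCocycle.apply_one_left {c : G × G → A} (hc : IsTrivialCocycle c) (g : G) :
    c (1, g) = c (1, 1) := by
  have := hc 1 1 g
  simp only [one_mul] at this
  exact (add_left_cancel this).symm

theorem IsTrivialCocycle.apply_one_right {c : G × G → A} (hc : IsTrivialCocycle c) (g : G) :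
    c (g, 1) = c (1, 1) := by
  have := hc g 1 1
  simp only [mul_one] at this
  exact add_right_cancel this

/-- The underlying set of the central extension of `G` by `A` that is defined by a cocycle. -/
structure CocycleExtension (c : G × G → A) (hc : IsTrivialCocycle c) where
  fst : A
  snd : G

namespace CocycleExtension

variable {c : G × G → A} {hc : IsTrivialCocycle c}

@[ext]
theorem ext {x y : CocycleExtension c hc} (h₁ : x.fst = y.fst) (h₂ : x.snd = y.snd) : x = y := by
  cases x; cases y; simp_all

instance : Mul (CocycleExtension c hc) :=
  ⟨fun x y => ⟨x.fst + y.fst + c (x.snd, y.snd), x.snd * y.snd⟩⟩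

/-- The cocycle need not be normalised, whence the shift by `c (1, 1)` here and in `incl`. -/
instance : One (CocycleExtension c hc) := ⟨⟨-c (1, 1), 1⟩⟩

instance : Inv (CocycleExtension c hc) :=
  ⟨fun x => ⟨-x.fst - c (x.snd⁻¹, x.snd) - c (1, 1), x.snd⁻¹⟩⟩

theorem fst_mul (x y : CocycleExtension c hc) :
    (x * y).fst = x.fst + y.fst + c (x.snd, y.snd) := rfl

theorem snd_mul (x y : CocycleExtension c hc) : (x * y).snd = x.snd * y.snd := rfl

instance : Group (CocycleExtension c hc) :=
  Group.ofLeftAxioms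
    (fun x y z => by
      ext
      · simp only [fst_mul, snd_mul]
        have := hc x.snd y.snd z.snd
        calc _ = x.fst + y.fst + z.fst + (c (x.snd * y.snd, z.snd) + c (x.snd, y.snd)) := by abel
          _ = _ := by rw [this]; abel
      · simp only [snd_mul, mul_assoc])
    (fun x => by
      ext
      · change -c (1, 1) + x.fst + c (1, x.snd) = x.fst
        rw [hc.apply_one_left x.snd]; abel
      · exact one_mul x.snd)
    (fun x => by
      ext
      · change -x.fst - c (x.snd⁻¹, x.snd) - c (1, 1) + x.fst + c (x.snd⁻¹, x.snd) = -c (1, 1)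
        abel
      · exact inv_mul_cancel x.snd)

variable (c hc)

/-- The projection of the central extension. -/
def proj : CocycleExtension c hc →* G where
  toFun := snd
  map_one' := rfl
  map_mul' _ _ := rfl

/-- The inclusion of the kernel of the central extension. -/
def incl (a : A) : CocycleExtension c hc := ⟨a - c (1, 1), 1⟩

variable {c hc}

theorem fst_incl_mul (a : A) (x : CocycleExtension c hc) :
    (incl c hc a * x).fst = a + x.fst := by
  change a - c (1, 1) + x.fst + c (1, x.snd) = _
  rw [hc.apply_one_left x.snd]; abel

theorem snd_incl_mul (a : A) (x : CocycleExtension c hc) :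
    (incl c hc a * x).snd = x.snd := one_mul _

theorem incl_add (a b : A) : incl c hc (a + b) = incl c hc a * incl c hc b := by
  ext
  · rw [fst_incl_mul]; simp [incl, add_sub_assoc]
  · rw [snd_incl_mul]; rfl

theorem incl_mem_center (a : A) : incl c hc a ∈ Subgroup.center (CocycleExtension c hc) := by
  refine Subgroup.mem_center_iff.2 fun x => ?_
  ext
  · rw [fst_incl_mul]
    change x.fst + (a - c (1, 1)) + c (x.snd, 1) = _
    rw [hc.apply_one_right x.snd]; abel
  · rw [snd_incl_mul]
    exact mul_one _

end CocycleExtension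

end CocycleExtension

/-! ### Evaluation of cochains on integral cycles. -/

section Evaluation

variable {G : Type} {A : Type*} [AddCommGroup A] [Module ℤ A]

theorem linearCombination_coboundary_eq_zero [Group G] (b : G → A)
    (z : groupHomology.cycles₂ (Rep.trivial ℤ G ℤ)) :
    Finsupp.linearCombination ℤ (fun x : G × G => b x.2 - b (x.1 * x.2) + b x.1) z.1 = 0 := by
  have key : ∀ w : G × G →₀ ℤ,
      Finsupp.linearCombination ℤ (fun x : G × G => b x.2 - b (x.1 * x.2) + b x.1) w =
        Finsupp.linearCombination ℤ b (intBoundary G w) := by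
    intro w
    induction w using Finsupp.induction_linear with
    | zero => simp
    | add u v hu hv => rw [map_add, map_add, map_add, hu, hv]
    | single x n =>
      rw [intBoundary_single]
      simp only [map_add, map_sub, Finsupp.linearCombination_single, smul_add, smul_sub]
  rw [key]
  exact (congrArg _ (LinearMap.mem_ker.1 z.2)).trans (map_zero _)

theorem linearCombination_add_apply (c d : G × G → A) (z : G × G →₀ ℤ) :
    Finsupp.linearCombination ℤ (fun x => c x + d x) z =
      Finsupp.linearCombination ℤ c z + Finsupp.linearCombination ℤ d z := by
  simp [Finsupp.linearCombination_apply, Finsupp.sum, Finset.sum_add_distrib]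

/-- Additive maps between `ℤ`-modules are linear. -/
def AddMonoidHom.toLinearMapInt {B : Type*} [AddCommGroup B] [Module ℤ B] (f : A →+ B) :
    A →ₗ[ℤ] B where
  toFun := f
  map_add' := map_add f
  map_smul' n a := by
    simpa using map_intCast_smul f ℤ ℤ n a

theorem linearCombination_comp_apply {B : Type*} [AddCommGroup B] [Module ℤ B] (f : A →+ B)
    (c : G × G → A) (z : G × G →₀ ℤ) :
    Finsupp.linearCombination ℤ (fun x => f (c x)) z = f (Finsupp.linearCombination ℤ c z) :=
  (LinearMap.map_finsupp_linearCombination f.toLinearMapInt z).symm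

end Evaluation

/-! ### Finite generation of the second homology. -/

section FiniteGeneration

variable {G : Type} [Group G]

/-- If the evaluation of a cocycle on `H_2(G; ℤ)` is onto, then the coefficient group of a finitely
presented group `G` is finitely generated. -/
theorem finite_of_surjective_evaluation (hG : Group.IsFinitelyPresented G) {A : Type*}
    [AddCommGroup A] [Module ℤ A] {c : G × G → A} (hc : IsTrivialCocycle c)
    (hsurj : ∀ a : A, ∃ z : groupHomology.cycles₂ (Rep.trivial ℤ G ℤ),
      Finsupp.linearCombination ℤ c z.1 = a) : Module.Finite ℤ A := by
  obtain ⟨n, π, hπ, R, hRfin, hR⟩ := hG.out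
  -- The presentation is lifted to the extension by `A`. For `π w = 1` the element `l w` is `incl (a
  -- w + c (1, 1))`, so `B` is generated by the finitely many values on relators.
  let l : FreeGroup (Fin n) →* CocycleExtension c hc :=
    FreeGroup.lift fun k => ⟨0, π (FreeGroup.of k)⟩
  have hl : (CocycleExtension.proj c hc).comp l = π := by
    ext k
    simp [l, CocycleExtension.proj]
  have hsnd : ∀ w, (l w).snd = π w := fun w => DFunLike.congr_fun hl w
  let a : FreeGroup (Fin n) → A := fun w => (l w).fst
  have hmul : ∀ w w', a (w * w') = a w + a w' + c (π w, π w') := fun w w' => by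
    simp only [a, map_mul, CocycleExtension.fst_mul, hsnd]
  have hone : a 1 = -c (1, 1) := by
    simp only [a, map_one]
    rfl
  let B : Submodule ℤ A := Submodule.span ℤ ((fun r => a r + c (1, 1)) '' R)
  -- A normal subgroup that contains `R`, hence the whole kernel of `π`.
  let N : Subgroup (FreeGroup (Fin n)) :=
    { carrier := {w | π w = 1 ∧ a w + c (1, 1) ∈ B}
      one_mem' := ⟨map_one π, by rw [hone, neg_add_cancel]; exact zero_mem _⟩
      mul_mem' := by
        rintro x y ⟨hx, hx'⟩ ⟨hy, hy'⟩
        refine ⟨by rw [map_mul, hx, hy, one_mul], ?_⟩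
        rw [hmul, hx, hy]
        convert add_mem hx' hy' using 1
        abel
      inv_mem' := by
        rintro x ⟨hx, hx'⟩
        have hxi : π x⁻¹ = 1 := by rw [map_inv, hx, inv_one]
        refine ⟨hxi, ?_⟩
        have h := hmul x x⁻¹
        rw [mul_inv_cancel, hone, hx, hxi] at h
        have h' : a x⁻¹ + c (1, 1) = -(a x + c (1, 1)) := by
          rw [eq_neg_iff_add_eq_zero]
          calc _ = a x + a x⁻¹ + c (1, 1) + c (1, 1) := by abel
            _ = 0 := by rw [← h, neg_add_cancel]
        rw [h']
        exact neg_mem hx' }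
  have hNnormal : N.Normal := ⟨by
    rintro r ⟨hr, hr'⟩ w
    have hs : π (w * r * w⁻¹) = 1 := by simp [hr]
    refine ⟨hs, ?_⟩
    have h1 := hmul (w * r * w⁻¹) w
    have h2 := hmul w r
    rw [inv_mul_cancel_right, hs, hc.apply_one_left] at h1
    rw [hr, hc.apply_one_right, h1] at h2
    have h3 : a (w * r * w⁻¹) = a r := by
      have := add_right_cancel h2
      rw [add_comm (a w)] at this
      exact add_right_cancel this
    rwa [h3]⟩
  have hker : ∀ w, π w = 1 → a w + c (1, 1) ∈ B := by
    intro w hw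
    have hRN : R ⊆ N := fun r hr => ⟨MonoidHom.mem_ker.1 (hR ▸ Subgroup.subset_normalClosure hr),
      Submodule.subset_span ⟨r, hr, rfl⟩⟩
    have := Subgroup.normalClosure_le_normal hRN
    rw [hR] at this
    exact (this (MonoidHom.mem_ker.2 hw)).2
  choose s hs using hπ
  let q : A →+ A ⧸ B.toAddSubgroup := QuotientAddGroup.mk' _
  have hq : ∀ x, q x = 0 ↔ x ∈ B := fun x => QuotientAddGroup.eq_zero_iff x
  -- Modulo `B` the fibre coordinate depends only on `π w`, so `c` becomes a coboundary there. Its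
  -- evaluation is then zero modulo `B` and onto, which leaves `B = ⊤`.
  have hconst : ∀ w, q (a w) = q (a (s (π w))) := by
    intro w
    have hr : π ((s (π w))⁻¹ * w) = 1 := by rw [map_mul, map_inv, hs, inv_mul_cancel]
    have h1 := hmul (s (π w)) ((s (π w))⁻¹ * w)
    rw [mul_inv_cancel_left, hr, hc.apply_one_right, add_assoc] at h1
    have h2 : q (a ((s (π w))⁻¹ * w) + c (1, 1)) = 0 := by
      exact (hq _).2 (hker _ hr)
    rw [h1, map_add, h2, add_zero]
  have hcob : ∀ g h, q (c (g, h)) = (fun g => -q (a (s g))) h -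
      (fun g => -q (a (s g))) (g * h) + (fun g => -q (a (s g))) g := by
    intro g h
    have h1 := congrArg q (hmul (s g) (s h))
    rw [hconst, map_mul, hs, hs, map_add, map_add] at h1
    simp only [h1]
    abel
  have htop : B = ⊤ := by
    rw [eq_top_iff]
    intro x _
    obtain ⟨z, rfl⟩ := hsurj x
    rw [← hq]
    have h1 := linearCombination_comp_apply q c z.1
    refine h1.symm.trans ?_
    rw [← linearCombination_coboundary_eq_zero (fun g => -q (a (s g))) z]
    congr 2
    funext x
    exact hcob x.1 x.2
  exact ⟨htop ▸ Submodule.fg_span (hRfin.image _)⟩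

/-- The tautological cocycle, whose evaluation is the identity of `H_2`, has a surjective
evaluation. -/
theorem finite_trivialHomology_two (hG : Group.IsFinitelyPresented G) :
    Module.Finite ℤ (trivialHomology ℤ G 2) := by
  obtain ⟨c, hc⟩ := exists_cocycle_kronecker_eq
    (LinearMap.id : trivialHomology ℤ G 2 →ₗ[ℤ] trivialHomology ℤ G 2)
  refine finite_of_surjective_evaluation hG (c := c.1)
    ((groupCohomology.mem_cocycles₂_iff c.1).1 c.2) fun a => ?_
  obtain ⟨z, rfl⟩ := groupHomology_H2π_surjective _ a
  exact ⟨z, (kronecker_H2π c z).symm.trans (LinearMap.congr_fun hc _)⟩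

end FiniteGeneration

/-! ### Coordinates on central extensions. -/

section CentralCoordinates

/-- A quasimorphism on an abelian group is at bounded distance from a homomorphism. -/
theorem exists_addMonoidHom_near {A : Type*} [AddCommGroup A] {f : A → ℝ} {D : ℝ}
    (hf : ∀ a b, |f (a + b) - f a - f b| ≤ D) : ∃ l : A →+ ℝ, ∀ a, |f a - l a| ≤ D := by
  -- Homogenisation along powers of two: consecutive terms differ by at most `D / 2 ^ (n + 1)`,
  -- which sums to `D`. Commutativity of `A` makes the limit additive.
  let u : A → ℕ → ℝ := fun a n => f ((2 ^ n : ℕ) • a) / 2 ^ n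
  have hu : ∀ a n, dist (u a n) (u a (n + 1)) ≤ D / 2 / 2 ^ n := by
    intro a n
    have h := hf ((2 ^ n : ℕ) • a) ((2 ^ n : ℕ) • a)
    rw [← two_nsmul, smul_smul, mul_comm, ← pow_succ] at h
    have h2 : u a n - u a (n + 1) = -(f ((2 ^ (n + 1) : ℕ) • a) - f ((2 ^ n : ℕ) • a) -
        f ((2 ^ n : ℕ) • a)) / 2 / 2 ^ n := by
      simp only [u]
      field_simp
      ring
    rw [Real.dist_eq, h2, abs_div, abs_div, abs_neg, abs_of_pos (by positivity : (0 : ℝ) < 2),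
      abs_of_pos (by positivity : (0 : ℝ) < 2 ^ n)]
    gcongr
  choose l hl using fun a => cauchySeq_tendsto_of_complete (cauchySeq_of_le_geometric_two (hu a))
  have hadd : ∀ a b, l (a + b) = l a + l b := by
    intro a b
    have h1 : Filter.Tendsto (fun n => u (a + b) n - u a n - u b n) Filter.atTop (nhds 0) := by
      refine squeeze_zero_norm (a := fun n : ℕ => D / 2 ^ n) (fun n => ?_) ?_
      · have h2 : u (a + b) n - u a n - u b n = (f ((2 ^ n : ℕ) • a + (2 ^ n : ℕ) • b) -
            f ((2 ^ n : ℕ) • a) - f ((2 ^ n : ℕ) • b)) / 2 ^ n := by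
          simp only [u, smul_add]
          ring
        rw [h2, Real.norm_eq_abs, abs_div, abs_of_pos (by positivity : (0 : ℝ) < 2 ^ n)]
        gcongr
        exact hf _ _
      · have := (tendsto_pow_atTop_nhds_zero_of_lt_one (r := (1 / 2 : ℝ)) (by norm_num)
          (by norm_num)).const_mul D
        simpa [div_eq_mul_inv] using this
    have h2 := tendsto_nhds_unique h1 (((hl (a + b)).sub (hl a)).sub (hl b))
    linarith
  refine ⟨AddMonoidHom.mk' l hadd, fun a => ?_⟩
  have := dist_le_of_le_geometric_two_of_tendsto₀ (hu a) (hl a)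
  simpa [u, Real.dist_eq] using this

variable {Γ : Type} {E : Type*} [Group Γ] [Group E] {A : Type*} [AddCommGroup A]

/-- A section and the associated fibre coordinate of a central extension with cocycle `c`. -/
structure CentralCoordinates (S : GroupExtension (Multiplicative A) E Γ) (c : Γ × Γ → A) where
  sec : Γ → E
  coord : E → A
  rightHom_sec : ∀ g, S.rightHom (sec g) = g
  inl_mul_sec : ∀ e, S.inl (Multiplicative.ofAdd (coord e)) * sec (S.rightHom e) = e
  coord_inl_mul : ∀ a e, coord (S.inl (Multiplicative.ofAdd a) * e) = a + coord e
  coord_mul : ∀ e e', coord (e * e') = coord e + coord e' + c (S.rightHom e, S.rightHom e')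

theorem exists_centralCoordinates (S : GroupExtension (Multiplicative A) E Γ)
    (hS : S.inl.range ≤ Subgroup.center E) (σ : S.Section) (c : Γ × Γ → A)
    (hc : ∀ g h : Γ, σ g * σ h = S.inl (Multiplicative.ofAdd (c (g, h))) * σ (g * h)) :
    Nonempty (CentralCoordinates S c) := by
  have hσ : ∀ g, S.rightHom (σ g) = g := σ.rightInverse_rightHom
  have hex : ∀ e, ∃ a : A, S.inl (Multiplicative.ofAdd a) = e * (σ (S.rightHom e))⁻¹ := by
    intro e
    have : e * (σ (S.rightHom e))⁻¹ ∈ S.inl.range := by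
      rw [S.range_inl_eq_ker_rightHom, MonoidHom.mem_ker, map_mul, map_inv, hσ, mul_inv_cancel]
    obtain ⟨a, ha⟩ := this
    exact ⟨Multiplicative.toAdd a, ha⟩
  choose F hF using hex
  have hFe : ∀ e, S.inl (Multiplicative.ofAdd (F e)) * σ (S.rightHom e) = e := fun e => by
    rw [hF, inv_mul_cancel_right]
  have huniq : ∀ a e, S.inl (Multiplicative.ofAdd a) * σ (S.rightHom e) = e → F e = a := by
    intro a e h
    have h2 := S.inl_injective (mul_right_cancel (h.trans (hFe e).symm))
    exact (Multiplicative.ofAdd.injective h2).symm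
  have hker : ∀ a, S.rightHom (S.inl a) = 1 := fun a =>
    MonoidHom.mem_ker.1 (S.range_inl_eq_ker_rightHom ▸ ⟨a, rfl⟩)
  refine ⟨⟨σ, F, hσ, hFe, fun a e => huniq _ _ ?_, fun e e' => huniq _ _ ?_⟩⟩
  · rw [map_mul, hker, one_mul, ofAdd_add, map_mul, mul_assoc, hFe]
  · have hcomm : ∀ a x, x * S.inl a = S.inl a * x := fun a x =>
      Subgroup.mem_center_iff.1 (hS ⟨a, rfl⟩) x
    conv_rhs => rw [← hFe e, ← hFe e']
    rw [map_mul, ofAdd_add, ofAdd_add, map_mul, map_mul, mul_assoc, mul_assoc, ← hc]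
    simp only [← mul_assoc]
    rw [mul_assoc (S.inl _) (σ (S.rightHom e)) (S.inl _), hcomm _ (σ (S.rightHom e))]
    simp only [mul_assoc]

namespace CentralCoordinates

variable {S : GroupExtension (Multiplicative A) E Γ} {c : Γ × Γ → A}

theorem isTrivialCocycle (K : CentralCoordinates S c) : IsTrivialCocycle c := by
  intro g h j
  have h1 := congrArg K.coord (mul_assoc (K.sec g) (K.sec h) (K.sec j))
  simp only [K.coord_mul, map_mul, K.rightHom_sec] at h1
  have h2 : K.coord (K.sec g) + K.coord (K.sec h) + K.coord (K.sec j) +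
      (c (g * h, j) + c (g, h)) = K.coord (K.sec g) + K.coord (K.sec h) + K.coord (K.sec j) +
      (c (h, j) + c (g, h * j)) := by
    calc _ = _ := by abel
      _ = _ := h1
      _ = _ := by abel
  exact add_left_cancel h2

variable (K : CentralCoordinates S c)

theorem coord_sec (g : Γ) : K.coord (K.sec g) = 0 := by
  have h := congrArg K.coord (K.inl_mul_sec (K.sec g))
  rw [K.coord_inl_mul, K.rightHom_sec] at h
  exact add_eq_right.1 h

theorem sec_mul_sec (g h : Γ) :
    K.sec g * K.sec h = S.inl (Multiplicative.ofAdd (c (g, h))) * K.sec (g * h) := by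
  conv_lhs => rw [← K.inl_mul_sec (K.sec g * K.sec h)]
  rw [K.coord_mul, map_mul, K.rightHom_sec, K.rightHom_sec, K.coord_sec, K.coord_sec, zero_add,
    zero_add]

theorem coord_inl (a : A) : K.coord (S.inl (Multiplicative.ofAdd a)) = a + K.coord 1 := by
  rw [← K.coord_inl_mul, mul_one]

theorem rightHom_inl (a : Multiplicative A) : S.rightHom (S.inl a) = 1 :=
  MonoidHom.mem_ker.1 (S.range_inl_eq_ker_rightHom ▸ ⟨a, rfl⟩)

/-- If the evaluation of the cocycle is onto up to torsion and `Γ` has no homomorphisms to `ℝ`,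
then neither has `E`. -/
theorem hom_eq_zero [Module ℤ A] (K : CentralCoordinates S c)
    (hΓ : ∀ χ : Additive Γ →+ ℝ, χ = 0) {m : ℕ} (hm : 0 < m)
    (hκ : ∀ a : A, ∃ z : groupHomology.cycles₂ (Rep.trivial ℤ Γ ℤ),
      Finsupp.linearCombination ℤ c z.1 = m • a) (χ : Additive E →+ ℝ) : χ = 0 := by
  let l : A →+ ℝ := χ.comp (MonoidHom.toAdditive S.inl : Additive (Multiplicative A) →+ Additive E)
  let u : Γ → ℝ := fun g => χ (Additive.ofMul (K.sec g))
  have hu : ∀ g h, u g + u h = l (c (g, h)) + u (g * h) := fun g h => by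
    have := congrArg (fun e => χ (Additive.ofMul e)) (K.sec_mul_sec g h)
    simp only [ofMul_mul, map_add] at this
    exact this
  -- The composite `l ∘ c` is the coboundary of `u`, so `l` kills the evaluations `m • a`. As `ℝ` is
  -- torsion free, `l = 0`, and then `u` is a homomorphism on `Γ`.
  have hl : ∀ a, l a = 0 := by
    intro a
    obtain ⟨z, hz⟩ := hκ a
    have h1 := linearCombination_comp_apply l c z.1
    have h2 := linearCombination_coboundary_eq_zero u z
    have h3 : (fun x : Γ × Γ => l (c x)) = fun x => u x.2 - u (x.1 * x.2) + u x.1 := by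
      funext x
      have := hu x.1 x.2
      linarith
    rw [h3, h2, hz, map_nsmul, nsmul_eq_mul] at h1
    rcases mul_eq_zero.1 h1.symm with h | h
    · exact absurd h (by positivity)
    · exact h
  have hu0 : ∀ g, u g = 0 := fun g => by
    have := hΓ (AddMonoidHom.mk' (fun g => u g.toMul) fun g h => by
      have := hu g.toMul h.toMul
      rw [hl, zero_add] at this
      exact this.symm)
    exact DFunLike.congr_fun this (Additive.ofMul g)
  refine AddMonoidHom.ext fun e => ?_
  have h1 := congrArg (fun e => χ (Additive.ofMul e)) (K.inl_mul_sec e.toMul)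
  simp only [ofMul_mul, map_add] at h1
  have h2 := hl (K.coord e.toMul)
  have h3 := hu0 (S.rightHom e.toMul)
  refine h1.symm.trans ?_
  exact (congrArg₂ (· + ·) h2 h3).trans (add_zero 0)

end CentralCoordinates

end CentralCoordinates

/-! ### Quasimorphisms on central extensions and the Euler class. -/

section EulerQuasimorphisms

variable {Γ : Type} [Group Γ] {ρ : Γ →* HomeoPlus}

namespace EulerSetup

/-- Finiteness of `H_1` is finiteness of the abelianisation, and `ℝ` is torsion free. -/
theorem hom_eq_zero (hρ : EulerSetup ρ) (χ : Additive Γ →+ ℝ) : χ = 0 := by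
  have hfin := hρ.finite_H1
  have hfin' : Finite (TensorProduct ℤ (Additive (Abelianization Γ)) ℤ) :=
    Finite.of_equiv _ (groupHomology.H1AddEquivOfIsTrivial (Rep.trivial ℤ Γ ℤ)).toEquiv
  have : Finite (Abelianization Γ) :=
    Finite.of_equiv (TensorProduct ℤ (Additive (Abelianization Γ)) ℤ) (TensorProduct.rid ℤ (Additive (Abelianization Γ))).toEquiv
  let f : Γ →* Multiplicative ℝ := AddMonoidHom.toMultiplicativeRight χ
  refine AddMonoidHom.ext fun g => ?_
  have hfin2 : IsOfFinOrder (Abelianization.of g.toMul) := isOfFinOrder_of_finite _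
  obtain ⟨n, hn, h⟩ := isOfFinOrder_iff_pow_eq_one.1 hfin2
  have h1 := congrArg (Abelianization.lift f) h
  rw [map_pow, map_one, Abelianization.lift_apply_of] at h1
  have h2 : n • χ g = 0 := h1
  rw [nsmul_eq_mul] at h2
  rcases mul_eq_zero.1 h2 with h | h
  · exact absurd h (by positivity)
  · exact h

theorem bounded_of_quasimorphism (hρ : EulerSetup ρ) {f : Γ → ℝ} {D : ℝ}
    (hf : ∀ g h, |f (g * h) - f g - f h| ≤ D) : ∃ C, ∀ g, |f g| ≤ C := by
  obtain ⟨χ, C, hC⟩ := hρ.quasimorphism_trivial ⟨f, D, hf⟩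
  refine ⟨C, fun g => ?_⟩
  have := hC g
  rwa [hρ.hom_eq_zero χ, AddMonoidHom.zero_apply, sub_zero] at this

theorem exists_boundedCoboundary (hρ : EulerSetup ρ) {β : Γ × Γ → ℝ} (hβ : IsTrivialCocycle β)
    {C : ℝ} (hC : ∀ x, |β x| ≤ C) : ∃ (t : ℝ) (v : Γ → ℝ), (∃ C, ∀ g, |v g| ≤ C) ∧
      ∀ g h, β (g, h) = t * eulerCocycle ρ (g, h) + (v h - v (g * h) + v g) := by
  let β' : boundedCocycles₂ Γ :=
    ⟨β, (groupCohomology.mem_cocycles₂_iff (A := Rep.trivial ℝ Γ ℝ) β).2 hβ, C, hC⟩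
  have hmem : (Submodule.Quotient.mk β' : BoundedCohomology₂ Γ) ∈
      Submodule.span ℝ {boundedEulerClass ρ} := hρ.span_boundedEulerClass ▸ Submodule.mem_top
  obtain ⟨t, ht⟩ := Submodule.mem_span_singleton.1 hmem
  rw [boundedEulerClass, ← Submodule.Quotient.mk_smul, eq_comm, Submodule.Quotient.eq] at ht
  obtain ⟨v, hv, h⟩ := ht
  refine ⟨t, v, hv, fun g h' => ?_⟩
  have := h g h'
  change β (g, h') - t * (eulerCocycle ρ (g, h') : ℝ) = _ at this
  linarith

theorem boundedEulerClass_ne_zero (hρ : EulerSetup ρ) : boundedEulerClass ρ ≠ 0 := by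
  intro h
  have h1 := hρ.span_boundedEulerClass
  rw [h, Submodule.span_zero_singleton] at h1
  have h2 := hρ.finrank_boundedCohomology
  have : Subsingleton (BoundedCohomology₂ Γ) := (Submodule.subsingleton_iff ℝ).1
    ((subsingleton_iff_bot_eq_top).1 h1)
  rw [Module.finrank_zero_of_subsingleton] at h2
  exact one_ne_zero h2.symm

/-- The Euler class does not vanish on the integral homology. -/
theorem exists_evaluation_ne_zero (hρ : EulerSetup ρ) :
    ∃ z : groupHomology.cycles₂ (Rep.trivial ℤ Γ ℤ),
      Finsupp.linearCombination ℤ (fun x => (eulerCocycle ρ x : ℝ)) z.1 ≠ 0 := by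
  by_contra! hcon
  -- Because its coboundary is the bounded Euler cocycle, `f` is a quasimorphism, hence bounded;
  -- this would make the bounded Euler class zero.
  obtain ⟨f, hf⟩ := exists_coboundary_of_vanishing _ hcon
  have hbound : ∀ x, |(eulerCocycle ρ x : ℝ)| ≤ 1 := fun x => by
    have h := eulerCocycle_mem ρ x
    have h0 : (0 : ℝ) ≤ eulerCocycle ρ x := by exact_mod_cast h.1
    rw [abs_of_nonneg h0]
    exact_mod_cast h.2
  obtain ⟨C, hC⟩ := hρ.bounded_of_quasimorphism (f := f) (D := 1) fun g h => by
    have h1 := hbound (g, h)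
    rw [hf] at h1
    rw [← abs_neg]
    convert h1 using 2
    ring
  exact hρ.boundedEulerClass_ne_zero ((Submodule.Quotient.mk_eq_zero _).2 ⟨f, ⟨C, hC⟩, hf⟩)

end EulerSetup

namespace CentralCoordinates

variable {E : Type*} [Group E] {A : Type*} [AddCommGroup A]
  {S : GroupExtension (Multiplicative A) E Γ} {c : Γ × Γ → A} (K : CentralCoordinates S c)

/-- The quasimorphism `χ ∘ coord + b ∘ π` on a central extension. -/
def coordQuasimorphism (χ : A →+ ℝ) (b : Γ → ℝ) (e : E) : ℝ :=
  χ (K.coord e) + b (S.rightHom e)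

/-- The deviation from additivity is exactly the Euler cocycle of the images in `Γ`, which lies
between `0` and `1`. -/
theorem coordQuasimorphism_mul {χ : A →+ ℝ} {b : Γ → ℝ}
    (hb : ∀ g h, χ (c (g, h)) = eulerCocycle ρ (g, h) + (b h - b (g * h) + b g)) (e e' : E) :
    |K.coordQuasimorphism χ b (e * e') - K.coordQuasimorphism χ b e -
      K.coordQuasimorphism χ b e'| ≤ 1 := by
  have h := eulerCocycle_mem ρ (S.rightHom e, S.rightHom e')
  have h0 : (0 : ℝ) ≤ eulerCocycle ρ (S.rightHom e, S.rightHom e') := by exact_mod_cast h.1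
  have h1 : (eulerCocycle ρ (S.rightHom e, S.rightHom e') : ℝ) ≤ 1 := by exact_mod_cast h.2
  have h2 := hb (S.rightHom e) (S.rightHom e')
  simp only [coordQuasimorphism, K.coord_mul, map_add, map_mul, h2]
  rw [abs_le]
  constructor <;> linarith

/-- Every quasimorphism on the central extension is at bounded distance from a multiple of
`coordQuasimorphism`. -/
theorem exists_near_coordQuasimorphism [Module ℤ A] (hρ : EulerSetup ρ) {χ : A →+ ℝ} {b : Γ → ℝ}
    (hb : ∀ g h, χ (c (g, h)) = eulerCocycle ρ (g, h) + (b h - b (g * h) + b g))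
    {m : ℕ} (hm : 0 < m)
    (hκ : ∀ a : A, ∃ z : groupHomology.cycles₂ (Rep.trivial ℤ Γ ℤ),
      Finsupp.linearCombination ℤ c z.1 = m • a)
    {f : E → ℝ} {D : ℝ} (hf : ∀ x y, |f (x * y) - f x - f y| ≤ D) :
    ∃ t C : ℝ, ∀ e, |f e - t * K.coordQuasimorphism χ b e| ≤ C := by
  obtain ⟨l, hl⟩ := exists_addMonoidHom_near (f := fun a => f (S.inl (Multiplicative.ofAdd a)))
    (D := D) (fun a a' => by rw [ofAdd_add, map_mul]; exact hf _ _)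
  let u : Γ → ℝ := fun g => f (K.sec g)
  have hfu : ∀ e, |f e - l (K.coord e) - u (S.rightHom e)| ≤ 2 * D := fun e => by
    have h1 := hf (S.inl (Multiplicative.ofAdd (K.coord e))) (K.sec (S.rightHom e))
    rw [K.inl_mul_sec] at h1
    have h2 := hl (K.coord e)
    rw [abs_le] at *
    constructor <;> linarith
  -- This is `l ∘ c - δu`. It is bounded because `f` is close to `l ∘ coord + u ∘ π`, so it
  -- represents a multiple `t` of the bounded Euler class.
  let β : Γ × Γ → ℝ := fun x => l (c x) + u (x.1 * x.2) - u x.1 - u x.2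
  have hβC : ∀ x, |β x| ≤ 3 * D := fun x => by
    have h1 := hfu (K.sec x.1 * K.sec x.2)
    have h2 := hf (K.sec x.1) (K.sec x.2)
    rw [K.coord_mul, map_mul, K.rightHom_sec, K.rightHom_sec, K.coord_sec, K.coord_sec, zero_add,
      zero_add] at h1
    simp only [β, u]
    simp only [u] at h1
    rw [abs_le] at *
    constructor <;> linarith
  have hβ : IsTrivialCocycle β := fun g h j => by
    have := congrArg l (K.isTrivialCocycle g h j)
    simp only [map_add] at this
    simp only [β, mul_assoc]
    linarith
  obtain ⟨t, v, -, hv⟩ := hρ.exists_boundedCoboundary hβ hβC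
  -- Both `l ∘ c` and `t * χ ∘ c` equal `t` times the Euler cocycle up to coboundaries, so `l - t *
  -- χ` kills all evaluations `m • a`.
  have hlχ : ∀ a, l a = t * χ a := by
    intro a
    obtain ⟨z, hz⟩ := hκ a
    let l' : A →+ ℝ := l - (AddMonoidHom.mulLeft t).comp χ
    let u' : Γ → ℝ := fun g => u g + v g - t * b g
    have h1 := linearCombination_comp_apply l' c z.1
    have h2 := linearCombination_coboundary_eq_zero u' z
    have h3 : (fun x : Γ × Γ => l' (c x)) = fun x => u' x.2 - u' (x.1 * x.2) + u' x.1 := by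
      funext x
      have e1 := hv x.1 x.2
      have e2 := hb x.1 x.2
      simp only [β] at e1
      simp only [l', u', AddMonoidHom.sub_apply, AddMonoidHom.comp_apply,
        AddMonoidHom.coe_mulLeft, e2]
      linarith
    rw [h3, h2, hz, map_nsmul, nsmul_eq_mul] at h1
    rcases mul_eq_zero.1 h1.symm with h | h
    · exact absurd h (by positivity)
    · simpa [l', sub_eq_zero] using h
  -- Now that `l = t * χ`, the deviation of `u - t * b` from additivity is `β - t * eulerCocycle`,
  -- which is bounded.
  obtain ⟨C, hC⟩ := hρ.bounded_of_quasimorphism (f := fun g => u g - t * b g) (D := 3 * D + |t|)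
    fun g h => by
      have h1 := hβC (g, h)
      have e1 : u (g * h) - t * b (g * h) - (u g - t * b g) - (u h - t * b h) =
          β (g, h) - t * eulerCocycle ρ (g, h) := by
        have e2 := hb g h
        simp only [β, hlχ, e2]
        ring
      have hmem := eulerCocycle_mem ρ (g, h)
      have h0 : (0 : ℝ) ≤ eulerCocycle ρ (g, h) := by exact_mod_cast hmem.1
      have h1' : (eulerCocycle ρ (g, h) : ℝ) ≤ 1 := by exact_mod_cast hmem.2
      rw [e1]
      refine (abs_sub _ _).trans (add_le_add h1 ?_)
      rw [abs_mul, abs_of_nonneg h0]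
      exact mul_le_of_le_one_right (abs_nonneg t) h1'
  refine ⟨t, 2 * D + C, fun e => ?_⟩
  have h1 := hfu e
  have h2 := hC (S.rightHom e)
  rw [hlχ] at h1
  simp only [coordQuasimorphism]
  rw [abs_le] at *
  constructor <;> linarith

/-- A coordinate quasimorphism with nonzero `χ` is unbounded. -/
theorem coordQuasimorphism_unbounded {χ : A →+ ℝ} (hχ : χ ≠ 0) (b : Γ → ℝ) :
    ¬ ∃ C, ∀ e, |K.coordQuasimorphism χ b e| ≤ C := by
  rintro ⟨C, hC⟩
  obtain ⟨a, ha⟩ := DFunLike.ne_iff.1 hχ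
  obtain ⟨n, hn⟩ := exists_nat_gt ((C + |χ (K.coord 1) + b 1|) / |χ a|)
  have hpos : 0 < |χ a| := abs_pos.2 ha
  rw [div_lt_iff₀ hpos] at hn
  have h1 := hC (S.inl (Multiplicative.ofAdd (n • a)))
  rw [coordQuasimorphism, K.coord_inl, rightHom_inl, map_add, map_nsmul, nsmul_eq_mul,
    add_assoc] at h1
  have h2 := abs_sub_abs_le_abs_sub ((n : ℝ) * χ a) (-(χ (K.coord 1) + b 1))
  rw [sub_neg_eq_add, abs_neg, abs_mul, Nat.abs_cast] at h2
  linarith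

end CentralCoordinates

/-- If `G` has no homomorphisms to `ℝ`, and all quasimorphisms on `G` are boundedly close to
multiples of one unbounded quasimorphism, then `Q(G)` is one-dimensional. -/
theorem finrank_quasimorphismSpace_eq_one {G : Type*} [Group G]
    (hG : ∀ χ : Additive G →+ ℝ, χ = 0) (f₀ : quasimorphisms G)
    (hf₀ : ¬ ∃ C, ∀ g, |f₀.1 g| ≤ C)
    (h : ∀ f : quasimorphisms G, ∃ t C : ℝ, ∀ g, |f.1 g - t * f₀.1 g| ≤ C) :
    Module.finrank ℝ (QuasimorphismSpace G) = 1 := by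
  refine finrank_eq_one_iff'.2 ⟨Submodule.Quotient.mk f₀, ?_, fun w => ?_⟩
  · intro h0
    obtain ⟨χ, C, hC⟩ := (Submodule.Quotient.mk_eq_zero _).1 h0
    refine hf₀ ⟨C, fun g => ?_⟩
    have := hC g
    rwa [hG χ, AddMonoidHom.zero_apply, sub_zero] at this
  · obtain ⟨f, rfl⟩ := Submodule.Quotient.mk_surjective _ w
    obtain ⟨t, C, hC⟩ := h f
    refine ⟨t, ?_⟩
    rw [← Submodule.Quotient.mk_smul, eq_comm, Submodule.Quotient.eq]
    exact ⟨0, C, fun g => by simpa using hC g⟩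

/-- Pullback along an epimorphism from a group without homomorphisms to `ℝ` is injective
on `Q`. -/
theorem quasimorphismMap_injective {G G' : Type*} [Group G] [Group G']
    (hG : ∀ χ : Additive G →+ ℝ, χ = 0) (ψ : G →* G') (hψ : Function.Surjective ψ) :
    Function.Injective (quasimorphismMap ψ) := by
  rw [injective_iff_map_eq_zero]
  intro x hx
  obtain ⟨f, rfl⟩ := Submodule.Quotient.mk_surjective _ x
  obtain ⟨χ, C, hC⟩ := (Submodule.Quotient.mk_eq_zero _).1 hx
  refine (Submodule.Quotient.mk_eq_zero _).2 ⟨0, C, fun g => ?_⟩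
  obtain ⟨g, rfl⟩ := hψ g
  have := hC g
  rwa [hG χ, AddMonoidHom.zero_apply] at this

end EulerQuasimorphisms

/-! ### Vanishing of the second real homology. -/

section RealHomology

/-- `H_2(G; ℝ)` vanishes if all real 2-cocycles are coboundaries. -/
theorem subsingleton_trivialHomology_two {G : Type} [Group G]
    (h : ∀ w : G × G → ℝ, IsTrivialCocycle w →
      ∃ u : G → ℝ, ∀ g g', w (g, g') = u g' - u (g * g') + u g) :
    Subsingleton (trivialHomology ℝ G 2) := by
  refine subsingleton_of_forall_eq 0 fun y => ?_
  obtain ⟨z, rfl⟩ := groupHomology_H2π_surjective _ y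
  refine (groupHomology.H2π_eq_zero_iff z).2 ?_
  by_contra hz
  -- A functional that kills boundaries but not `z` is a cocycle, and as a coboundary it would
  -- vanish on the cycle `z`.
  obtain ⟨F, hFz, hF⟩ := Submodule.exists_le_ker_of_notMem hz
  let F' : (G × G →₀ ℝ) →ₗ[ℝ] ℝ := F
  let w : G × G → ℝ := fun x => F' (Finsupp.single x 1)
  have hFw : ∀ v : G × G →₀ ℝ, Finsupp.linearCombination ℝ w v = F' v := by
    intro v
    induction v using Finsupp.induction_linear with
    | zero => simp
    | add u v hu hv => rw [map_add, map_add, hu, hv]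
    | single x n =>
      rw [Finsupp.linearCombination_single]
      exact (F'.map_smul n _).symm.trans (by rw [Finsupp.smul_single_one])
  have hw : IsTrivialCocycle w := by
    intro g h j
    let b : G × G →₀ ℝ := (groupHomology.d₃₂ (Rep.trivial ℝ G ℝ)).hom (Finsupp.single (g, h, j) 1)
    have hb : b = Finsupp.single (h, j) 1 - Finsupp.single (g * h, j) 1 +
        Finsupp.single (g, h * j) 1 - Finsupp.single (g, h) 1 :=
      groupHomology.d₃₂_single _ _
    have hb0 : F' b = 0 := LinearMap.mem_ker.1 (hF ⟨_, rfl⟩)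
    rw [hb, map_sub, map_add, map_sub] at hb0
    simp only [w]
    linarith
  obtain ⟨u, hu⟩ := h w hw
  have key : ∀ v : G × G →₀ ℝ, F' v = Finsupp.linearCombination ℝ u
      ((groupHomology.d₂₁ (Rep.trivial ℝ G ℝ)).hom v) := by
    intro v
    rw [← hFw]
    induction v using Finsupp.induction_linear with
    | zero => simp
    | add u v hu hv => rw [map_add, map_add, map_add, hu, hv]
    | single x r =>
      obtain ⟨g, g'⟩ := x
      erw [groupHomology.d₂₁_single]
      simp only [map_add, map_sub, Finsupp.linearCombination_single, hu]
      change r * _ = r * u g' - r * u (g * g') + r * u g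
      ring
  refine hFz ((key z.1).trans ?_)
  exact (congrArg _ (LinearMap.mem_ker.1 z.2)).trans (map_zero _)

/-- `ℝ` is a retract of every abelian group that contains it. -/
theorem exists_real_retraction {B : Type*} [AddGroup B] (hB : ∀ x y : B, x + y = y + x)
    (i : ℝ →+ B) (hi : Function.Injective i) : ∃ r : B →+ ℝ, ∀ t, r (i t) = t := by
  let _ : AddCommGroup B := { ‹AddGroup B› with add_comm := hB }
  obtain ⟨r, hr⟩ := (Module.Baer.of_divisible ℝ).extension_property_addMonoidHom i hi
    (AddMonoidHom.id ℝ)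
  exact ⟨r, fun t => DFunLike.congr_fun hr t⟩

namespace CentralCoordinates

variable {Γ E : Type} [Group Γ] [Group E]

/-- For central `x` the cocycle identity makes `e ↦ w (x, e) - w (e, x)` a homomorphism. Its
vanishing means that central elements of `E` stay central in the extension by `ℝ`. -/
theorem real_cocycle_symmetric (hE : ∀ χ : Additive E →+ ℝ, χ = 0) {w : E × E → ℝ}
    (hw : IsTrivialCocycle w) {x : E} (hx : x ∈ Subgroup.center E) (e : E) :
    w (x, e) = w (e, x) := by
  have hcomm : ∀ e, e * x = x * e := Subgroup.mem_center_iff.1 hx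
  have := hE (AddMonoidHom.mk' (fun e => w (x, e.toMul) - w (e.toMul, x)) fun a b => by
    have h1 := hw x a.toMul b.toMul
    have h2 := hw a.toMul x b.toMul
    have h3 := hw a.toMul b.toMul x
    rw [hcomm] at h2 h3
    change w (x, a.toMul * b.toMul) - w (a.toMul * b.toMul, x) = _
    linarith)
  exact sub_eq_zero.1 (DFunLike.congr_fun this (Additive.ofMul e))

/-- If the evaluation of the cocycle of a central extension `E` by `A = H_2(Γ; ℤ)` is a nonzero
multiple of the identity and `E` has no homomorphisms to `ℝ`, then every real 2-cocycle on `E` is a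
coboundary. -/
theorem exists_real_coboundary
    {S : GroupExtension (Multiplicative (trivialHomology ℤ Γ 2)) E Γ}
    (hS : S.inl.range ≤ Subgroup.center E)
    {c : groupCohomology.cocycles₂ (Rep.trivial ℤ Γ (trivialHomology ℤ Γ 2))}
    (K : CentralCoordinates S (fun x => (c.1 x : trivialHomology ℤ Γ 2)))
    {m : ℕ} (hm : 0 < m)
    (hκ : ∀ x, kronecker ((groupCohomology.H2π _).hom c) x = m • x)
    (hE : ∀ χ : Additive E →+ ℝ, χ = 0) {w : E × E → ℝ} (hw : IsTrivialCocycle w) :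
    ∃ u : E → ℝ, ∀ e e', w (e, e') = u e' - u (e * e') + u e := by
  -- The extension of `E` by `ℝ` is regarded as an extension of `Γ`; its kernel is still central.
  let q : CocycleExtension w hw →* Γ := S.rightHom.comp (CocycleExtension.proj w hw)
  have hq : ∀ p, q p = S.rightHom p.snd := fun p => rfl
  have hcenter : ∀ p : CocycleExtension w hw, q p = 1 → p ∈ Subgroup.center (CocycleExtension w hw) := by
    intro p hp
    have hpc : p.snd ∈ Subgroup.center E := hS (by
      rw [S.range_inl_eq_ker_rightHom]
      exact MonoidHom.mem_ker.2 hp)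
    refine Subgroup.mem_center_iff.2 fun x => ?_
    refine CocycleExtension.ext ?_ (Subgroup.mem_center_iff.1 hpc x.snd)
    rw [CocycleExtension.fst_mul, CocycleExtension.fst_mul,
      real_cocycle_symmetric hE hw hpc, add_comm x.fst]
  let i : ℝ →+ Additive (Subgroup.center (CocycleExtension w hw)) :=
    AddMonoidHom.mk' (fun t => Additive.ofMul
      ⟨CocycleExtension.incl w hw t, CocycleExtension.incl_mem_center t⟩) fun s t =>
        congrArg Additive.ofMul (Subtype.ext (CocycleExtension.incl_add s t))
  have hi : Function.Injective i := fun s t hst => by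
    have h1 : CocycleExtension.incl w hw s = CocycleExtension.incl w hw t :=
      congrArg Subtype.val (congrArg Additive.toMul hst)
    have h2 := congrArg CocycleExtension.fst h1
    simpa [CocycleExtension.incl] using h2
  -- Splitting `ℝ` off the centre pushes the extension out to one of `Γ` by `ℝ`, with coordinate `R`
  -- and cocycle `α`.
  obtain ⟨r, hr⟩ :=
    exists_real_retraction (B := Additive (Subgroup.center (CocycleExtension w hw)))
      (fun x y => Subtype.ext (Subgroup.mem_center_iff.1 y.toMul.2 x.toMul.1)) i hi
  let s : Γ → CocycleExtension w hw := fun g => ⟨0, K.sec g⟩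
  have hs : ∀ g, q (s g) = g := K.rightHom_sec
  have hfib : ∀ p : CocycleExtension w hw, p * (s (q p))⁻¹ ∈ Subgroup.center (CocycleExtension w hw) := fun p => hcenter _ (by
    rw [map_mul, map_inv, hs, mul_inv_cancel])
  let R : CocycleExtension w hw → ℝ := fun p => r (Additive.ofMul ⟨p * (s (q p))⁻¹, hfib p⟩)
  have hcoc : ∀ g h, s g * s h * (s (g * h))⁻¹ ∈ Subgroup.center (CocycleExtension w hw) := fun g h => hcenter _ (by
    rw [map_mul, map_mul, map_inv, hs, hs, hs, mul_inv_cancel])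
  let α : Γ × Γ → ℝ := fun x => r (Additive.ofMul ⟨_, hcoc x.1 x.2⟩)
  have hR : ∀ p p', R (p * p') = R p + R p' + α (q p, q p') := by
    intro p p'
    simp only [R, α]
    rw [← map_add, ← map_add, ← ofMul_mul, ← ofMul_mul]
    congr 2
    refine Subtype.ext ?_
    simp only [Subgroup.coe_mul]
    have hcomm := Subgroup.mem_center_iff.1 (hfib p')
    rw [map_mul]
    have h1 : p * p' = (p * (s (q p))⁻¹) * (s (q p) * (p' * (s (q p'))⁻¹)) * s (q p') := by group
    rw [h1, hcomm]
    group
  have hRi : ∀ t p, R (CocycleExtension.incl w hw t * p) = t + R p := by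
    intro t p
    conv_rhs => rw [← hr t]
    simp only [R]
    rw [← map_add]
    congr 1
    refine congrArg Additive.ofMul (Subtype.ext ?_)
    have h1 : q (CocycleExtension.incl w hw t * p) = q p := by
      rw [hq, CocycleExtension.snd_incl_mul, hq]
    change CocycleExtension.incl w hw t * p * _ = CocycleExtension.incl w hw t * (p * _)
    rw [h1, mul_assoc]
  have hα : IsTrivialCocycle α := by
    intro g h j
    have h1 := congrArg R (mul_assoc (s g) (s h) (s j))
    simp only [hR, map_mul, hs] at h1
    linarith
  let α' : groupCohomology.cocycles₂ (Rep.trivial ℤ Γ (ModuleCat.of ℤ ℝ)) :=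
    ⟨α, (groupCohomology.mem_cocycles₂_iff (A := Rep.trivial ℤ Γ (ModuleCat.of ℤ ℝ)) α).2 hα⟩
  let a : trivialHomology ℤ Γ 2 →ₗ[ℤ] ℝ :=
    kronecker ((groupCohomology.H2π (Rep.trivial ℤ Γ (ModuleCat.of ℤ ℝ))).hom α')
  have hm' : (m : ℝ) ≠ 0 := by positivity
  -- The evaluation of `c` is `m` times the identity, so `a' ∘ c` has the same evaluation `a` as
  -- `α`.
  let a' : trivialHomology ℤ Γ 2 →+ ℝ := (AddMonoidHom.mulLeft (m : ℝ)⁻¹).comp a.toAddMonoidHom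
  obtain ⟨b, hb⟩ := exists_coboundary_of_vanishing (fun x => α x + (-a') (c.1 x)) fun z => by
    rw [linearCombination_add_apply]
    have h1 : Finsupp.linearCombination ℤ α z.1 =
        a ((groupHomology.H2π (Rep.trivial ℤ Γ ℤ)).hom z) := (kronecker_H2π α' z).symm
    have h2 : Finsupp.linearCombination ℤ (fun x => (c.1 x : trivialHomology ℤ Γ 2)) z.1 =
        m • ((groupHomology.H2π (Rep.trivial ℤ Γ ℤ)).hom z) := (kronecker_H2π c z).symm.trans (hκ _)
    have h3 := linearCombination_comp_apply (-a')
      (fun x => (c.1 x : trivialHomology ℤ Γ 2)) z.1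
    refine (congrArg₂ (· + ·) h1 (h3.trans (congrArg (-a') h2))).trans ?_
    rw [map_nsmul, nsmul_eq_mul]
    change _ + (m : ℝ) * (-((m : ℝ)⁻¹ * a _)) = 0
    field_simp
    ring
  -- A homomorphism that is the identity on `ℝ`; it splits the extension, and its values on the
  -- section `e ↦ (0, e)` bound `w`.
  let f : CocycleExtension w hw → ℝ := fun p => R p - a' (K.coord p.snd) + b (q p)
  have hf : ∀ p p', f (p * p') = f p + f p' := by
    intro p p'
    have h1 := hb (q p) (q p')
    have h2 := congrArg a' (K.coord_mul p.snd p'.snd)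
    rw [map_add, map_add] at h2
    simp only [f, hR, CocycleExtension.snd_mul, map_mul]
    rw [h2]
    simp only [AddMonoidHom.neg_apply, hq] at h1
    simp only [hq]
    linarith
  have hfi : ∀ t p, f (CocycleExtension.incl w hw t * p) = t + f p := by
    intro t p
    simp only [f, hRi, hq, CocycleExtension.snd_incl_mul]
    ring
  refine ⟨fun e => f ⟨0, e⟩, fun e e' => ?_⟩
  have h1 := hf ⟨0, e⟩ ⟨0, e'⟩
  have h2 : (⟨0, e⟩ * ⟨0, e'⟩ : CocycleExtension w hw) = CocycleExtension.incl w hw (w (e, e')) * ⟨0, e * e'⟩ := by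
    refine CocycleExtension.ext ?_ ?_
    · rw [CocycleExtension.fst_incl_mul, CocycleExtension.fst_mul]
      simp
    · rw [CocycleExtension.snd_incl_mul]
      rfl
  rw [h2, hfi] at h1
  linarith

end CentralCoordinates

end RealHomology

/-! ### Change of coefficients. -/

section Coefficients

variable {G : Type} [Group G] {A B : ModuleCat.{0} ℤ}

/-- The image of a cocycle under a homomorphism of coefficients. -/
def mapCocycle (f : A →ₗ[ℤ] B) (c : groupCohomology.cocycles₂ (Rep.trivial ℤ G A)) :
    groupCohomology.cocycles₂ (Rep.trivial ℤ G B) :=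
  ⟨fun x => f (c.1 x), (groupCohomology.mem_cocycles₂_iff (A := Rep.trivial ℤ G B) _).2
    fun g h j => by
      have := (groupCohomology.mem_cocycles₂_iff (A := Rep.trivial ℤ G A) c.1).1 c.2 g h j
      have h2 := congrArg f this
      exact (map_add f _ _).symm.trans (h2.trans (map_add f _ _))⟩

theorem coefficientMap₂_H2π (f : A ⟶ B) (c : groupCohomology.cocycles₂ (Rep.trivial ℤ G A)) :
    coefficientMap₂ f ((groupCohomology.H2π (Rep.trivial ℤ G A)).hom c) =
      (groupCohomology.H2π (Rep.trivial ℤ G B)).hom (mapCocycle f.hom c) := by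
  have h := groupCohomology.H2π_comp_map (A := Rep.trivial ℤ G A) (B := Rep.trivial ℤ G B)
    (MonoidHom.id G) ((Rep.trivialFunctor ℤ G).map f)
  have h1 := congrArg (fun t => t.hom c) h
  refine Eq.trans h1 ?_
  refine congrArg (groupCohomology.H2π (Rep.trivial ℤ G B)).hom (Subtype.ext ?_)
  rfl

theorem kronecker_coefficientMap₂ (f : A ⟶ B) (φ : trivialCohomology₂ G A)
    (x : trivialHomology ℤ G 2) :
    kronecker (coefficientMap₂ f φ) x = f.hom (kronecker φ x) := by
  obtain ⟨c, rfl⟩ := groupCohomology_H2π_surjective _ φ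
  obtain ⟨z, rfl⟩ := groupHomology_H2π_surjective _ x
  rw [coefficientMap₂_H2π]
  refine (kronecker_H2π _ z).trans ?_
  refine Eq.trans ?_ (congrArg f.hom (kronecker_H2π c z)).symm
  exact linearCombination_comp_apply f.hom.toAddMonoidHom (fun x => (c.1 x : A)) z.1

theorem coefficientMap₂_comp_eq_self {f : A ⟶ B} {s : B ⟶ A}
    (h : ∀ b, f.hom (s.hom b) = b) (φ : trivialCohomology₂ G B) :
    coefficientMap₂ f (coefficientMap₂ s φ) = φ := by
  obtain ⟨c, rfl⟩ := groupCohomology_H2π_surjective _ φ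
  rw [coefficientMap₂_H2π, coefficientMap₂_H2π]
  congr 1
  refine Subtype.ext (funext fun x => h _)

theorem exists_coboundary_of_H2π_eq {c d : groupCohomology.cocycles₂ (Rep.trivial ℤ G A)}
    (h : (groupCohomology.H2π (Rep.trivial ℤ G A)).hom c =
      (groupCohomology.H2π (Rep.trivial ℤ G A)).hom d) :
    ∃ b : G → A, ∀ g j, (c.1 (g, j) : A) = d.1 (g, j) + (b j - b (g * j) + b g) := by
  have h1 : (groupCohomology.H2π (Rep.trivial ℤ G A)).hom (c - d) = 0 := by
    rw [map_sub, h, sub_self]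
  obtain ⟨b, hb⟩ := (groupCohomology.H2π_eq_zero_iff (c - d)).1 h1
  refine ⟨b, fun g j => ?_⟩
  have h2 : (b j - b (g * j) + b g : A) = c.1 (g, j) - d.1 (g, j) := congrFun hb (g, j)
  rw [h2, add_sub_cancel]

end Coefficients

/-! ### Homomorphisms between central extensions. -/

section Pushout

variable {Γ : Type} {E E' : Type*} [Group Γ] [Group E] [Group E'] {A A' : Type*} [AddCommGroup A]
  [AddCommGroup A'] {S : GroupExtension (Multiplicative A) E Γ}
  {S' : GroupExtension (Multiplicative A') E' Γ} {c : Γ × Γ → A} {c' : Γ × Γ → A'}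

/-- A homomorphism of coefficients that matches the classes of two central extensions
is covered by a homomorphism of the extensions. -/
theorem CentralCoordinates.exists_hom (K : CentralCoordinates S c) (K' : CentralCoordinates S' c')
    (hS' : S'.inl.range ≤ Subgroup.center E') (f : A →+ A') (b : Γ → A')
    (hb : ∀ g h, f (c (g, h)) = c' (g, h) + (b h - b (g * h) + b g)) :
    ∃ ψ : E →* E', (∀ a, ψ (S.inl (Multiplicative.ofAdd a)) =
      S'.inl (Multiplicative.ofAdd (f a))) ∧ S'.rightHom.comp ψ = S.rightHom := by
  have hcomm : ∀ a x, x * S'.inl a = S'.inl a * x := fun a x =>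
    Subgroup.mem_center_iff.1 (hS' ⟨a, rfl⟩) x
  -- The term `b` compensates for the coboundary between `f ∘ c` and `c'`.
  let T : E → E' := fun e => S'.inl (Multiplicative.ofAdd (f (K.coord e) + b (S.rightHom e))) *
    K'.sec (S.rightHom e)
  let ψ : E →* E' := MonoidHom.mk' T fun e e' => by
    simp only [T]
    have h1 : f (K.coord (e * e')) + b (S.rightHom (e * e')) =
        (f (K.coord e) + b (S.rightHom e)) + (f (K.coord e') + b (S.rightHom e')) +
          c' (S.rightHom e, S.rightHom e') := by
      rw [K.coord_mul, map_add, map_add, hb, map_mul]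
      abel
    rw [h1, ofAdd_add _ (c' _), ofAdd_add (f (K.coord e) + _), map_mul, map_mul,
      mul_assoc _ (S'.inl (Multiplicative.ofAdd (c' _))), map_mul, ← K'.sec_mul_sec]
    simp only [← mul_assoc]
    rw [mul_assoc (S'.inl _) (K'.sec (S.rightHom e)) (S'.inl _), hcomm _ (K'.sec (S.rightHom e))]
    simp only [mul_assoc]
  refine ⟨ψ, fun a => ?_, ?_⟩
  · have h1 : ψ (S.inl (Multiplicative.ofAdd a) * 1) =
        S'.inl (Multiplicative.ofAdd (f a)) * ψ 1 := by
      change T _ = _ * T 1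
      simp only [T]
      rw [K.coord_inl_mul, map_mul, CentralCoordinates.rightHom_inl, one_mul, f.map_add, map_one,
        add_assoc, ofAdd_add (f a), map_mul, mul_assoc]
    rwa [mul_one, map_one, mul_one] at h1
  · ext e
    change S'.rightHom (T e) = _
    rw [map_mul, CentralCoordinates.rightHom_inl, one_mul, K'.rightHom_sec]

theorem surjective_of_covers {f : A → A'} (hf : Function.Surjective f) {ψ : E →* E'}
    (hψ : ∀ a, ψ (S.inl (Multiplicative.ofAdd a)) = S'.inl (Multiplicative.ofAdd (f a)))
    (hψ' : S'.rightHom.comp ψ = S.rightHom) : Function.Surjective ψ := by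
  intro y
  obtain ⟨e, he⟩ := S.rightHom_surjective (S'.rightHom y)
  have hmem : y * (ψ e)⁻¹ ∈ S'.inl.range := by
    rw [S'.range_inl_eq_ker_rightHom, MonoidHom.mem_ker, map_mul, map_inv, ← MonoidHom.comp_apply,
      hψ', he, mul_inv_cancel]
  obtain ⟨a', ha'⟩ := hmem
  obtain ⟨a, ha⟩ := hf (Multiplicative.toAdd a')
  refine ⟨S.inl (Multiplicative.ofAdd a) * e, ?_⟩
  rw [map_mul, hψ, ha, ofAdd_toAdd, ha', inv_mul_cancel_right]

theorem ker_le_range_of_covers {ψ : E →* E'} (hψ : S'.rightHom.comp ψ = S.rightHom) :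
    ψ.ker ≤ S.inl.range := by
  rw [S.range_inl_eq_ker_rightHom, ← hψ]
  intro e he
  rw [MonoidHom.mem_ker, MonoidHom.comp_apply, MonoidHom.mem_ker.1 he, map_one]

end Pushout

/-! ### Divisibility of the Euler class and the class `φ`. -/

section EulerClass

variable {Γ : Type} [Group Γ] {ρ : Γ →* HomeoPlus}

theorem EulerSetup.kronecker_ne_zero (hρ : EulerSetup ρ) :
    ∃ x, kronecker (eulerClass ρ) x ≠ (0 : ℤ) := by
  obtain ⟨z, hz⟩ := hρ.exists_evaluation_ne_zero
  refine ⟨(groupHomology.H2π (Rep.trivial ℤ Γ ℤ)).hom z, fun h0 => hz ?_⟩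
  have h1 := (kronecker_H2π (A := ModuleCat.of ℤ ℤ)
    ⟨eulerCocycle ρ, (groupCohomology.mem_cocycles₂_iff _).2 (eulerCocycle_identity ρ)⟩ z).symm.trans
    h0
  have h2 := linearCombination_comp_apply (Int.castAddHom ℝ) (eulerCocycle ρ) z.1
  exact h2.trans ((congrArg (Int.castAddHom ℝ) h1).trans (map_zero _))

/-- The image of the evaluation of the Euler class, and the normalised evaluation. -/
theorem EulerSetup.exists_epsilon (hρ : EulerSetup ρ) :
    ∃ (m : ℕ) (ε : trivialHomology ℤ Γ 2 →ₗ[ℤ] ℤ), 0 < m ∧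
      Set.range (kronecker (eulerClass ρ)) = {n : ℤ | (m : ℤ) ∣ n} ∧
      (∀ x, (m : ℤ) * ε x = kronecker (eulerClass ρ) x) ∧ ∃ x, ε x = 1 := by
  let κ : trivialHomology ℤ Γ 2 →ₗ[ℤ] ℤ := kronecker (eulerClass ρ)
  let d : ℤ := Submodule.IsPrincipal.generator (LinearMap.range κ)
  have hd : ∀ n : ℤ, n ∈ LinearMap.range κ ↔ d ∣ n := fun n =>
    Submodule.IsPrincipal.mem_iff_generator_dvd (LinearMap.range κ)
  have hd0 : d ≠ 0 := by
    intro h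
    obtain ⟨x, hx⟩ := hρ.kronecker_ne_zero
    have := (hd (κ x)).1 ⟨x, rfl⟩
    rw [h, zero_dvd_iff] at this
    exact hx this
  have hm0 : 0 < d.natAbs := Int.natAbs_pos.2 hd0
  have hmem : ∀ n : ℤ, n ∈ LinearMap.range κ ↔ (d.natAbs : ℤ) ∣ n := fun n => by
    rw [hd, Int.natAbs_dvd]
  choose ε hε using fun x => (hmem (κ x)).1 ⟨x, rfl⟩
  have hm0' : (d.natAbs : ℤ) ≠ 0 := by exact_mod_cast hm0.ne'
  let ε' : trivialHomology ℤ Γ 2 →+ ℤ := AddMonoidHom.mk' ε fun x y =>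
    mul_left_cancel₀ hm0' (by rw [← hε, map_add, hε, hε, mul_add])
  refine ⟨d.natAbs, ε'.toLinearMapInt, hm0, Set.ext fun n => hmem n, fun x => (hε x).symm, ?_⟩
  obtain ⟨x, hx⟩ := (hmem d.natAbs).2 dvd_rfl
  exact ⟨x, mul_left_cancel₀ hm0' ((hε x).symm.trans (hx.trans (mul_one _).symm))⟩

/-- Start from any `φ₀` with evaluation `m • id`. Its image under `ε` differs from `eu` by a class
with zero evaluation. Pushing this difference back along a section of `ε` and subtracting it
corrects the image and keeps the evaluation. -/
theorem exists_coefficient_class {m : ℕ} {ε : trivialHomology ℤ Γ 2 →ₗ[ℤ] ℤ}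
    {eu : trivialCohomology₂ Γ (ModuleCat.of ℤ ℤ)} (hε : ∀ x, (m : ℤ) * ε x = kronecker eu x)
    (h1 : ∃ x, ε x = 1) :
    ∃ φ : trivialCohomology₂ Γ (trivialHomology ℤ Γ 2),
      coefficientMap₂ (ModuleCat.ofHom ε : trivialHomology ℤ Γ 2 ⟶ ModuleCat.of ℤ ℤ) φ = eu ∧
        ∀ x, kronecker φ x = m • x := by
  obtain ⟨y, hy⟩ := h1
  obtain ⟨c, hc⟩ := exists_cocycle_kronecker_eq
    (m • (LinearMap.id : trivialHomology ℤ Γ 2 →ₗ[ℤ] trivialHomology ℤ Γ 2))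
  set φ₀ := (groupCohomology.H2π (Rep.trivial ℤ Γ (trivialHomology ℤ Γ 2))).hom c
  let s : ModuleCat.of ℤ ℤ ⟶ trivialHomology ℤ Γ 2 := ModuleCat.ofHom (LinearMap.toSpanSingleton ℤ _ y)
  let e : trivialHomology ℤ Γ 2 ⟶ ModuleCat.of ℤ ℤ := ModuleCat.ofHom ε
  have hes : ∀ n, e.hom (s.hom n) = n := fun n => by
    change ε (LinearMap.toSpanSingleton ℤ (trivialHomology ℤ Γ 2) y n) = n
    refine (ε.map_smul n y).trans ?_
    rw [hy]
    exact mul_one n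
  have hφ₀ : ∀ x, kronecker φ₀ x = m • x := fun x => LinearMap.congr_fun hc x
  refine ⟨φ₀ - coefficientMap₂ s (coefficientMap₂ e φ₀ - eu), ?_, fun x => ?_⟩
  · change coefficientMap₂ e _ = eu
    rw [map_sub, coefficientMap₂_comp_eq_self hes, sub_sub_cancel]
  · have h2 : kronecker (coefficientMap₂ e φ₀ - eu) x = 0 := by
      rw [map_sub, LinearMap.sub_apply, kronecker_coefficientMap₂, hφ₀, map_nsmul, ← hε]
      change m • ε x - (m : ℤ) * ε x = 0
      rw [nsmul_eq_mul]
      exact sub_self _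
    rw [map_sub, LinearMap.sub_apply, kronecker_coefficientMap₂, h2, map_zero, sub_zero, hφ₀]

end EulerClass

/-! ### The main theorem. -/

theorem mainTheorem8 {Γ : Type} [Group Γ] (ρ : Γ →* HomeoPlus) (hρ : EulerSetup ρ) :
    ∃ (m : ℕ) (ε : trivialHomology ℤ Γ 2 ⟶ ModuleCat.of ℤ ℤ),
      0 < m ∧
      Set.range (kronecker (eulerClass ρ)) = {n : ℤ | (m : ℤ) ∣ n} ∧
      (∀ x : trivialHomology ℤ Γ 2, (m : ℤ) * ε x = kronecker (eulerClass ρ) x) ∧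
      (∃ φ : trivialCohomology₂ Γ (trivialHomology ℤ Γ 2),
        coefficientMap₂ ε φ = eulerClass ρ ∧ ∀ x, kronecker φ x = m • x) ∧
      ∀ φ : trivialCohomology₂ Γ (trivialHomology ℤ Γ 2),
        coefficientMap₂ ε φ = eulerClass ρ → (∀ x, kronecker φ x = m • x) →
        ∀ (E Γt : Type) [Group E] [Group Γt]
          (S : GroupExtension (Multiplicative (trivialHomology ℤ Γ 2)) E Γ)
          (St : GroupExtension (Multiplicative (ModuleCat.of ℤ ℤ)) Γt Γ),
          IsCentralExtensionOfClass S φ → IsCentralExtensionOfClass St (eulerClass ρ) →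
          (Group.IsFinitelyPresented E ∧ Subsingleton (trivialHomology ℝ E 2)) ∧
          (∃ ψ : E →* Γt, Function.Surjective ψ ∧
            (∀ x : trivialHomology ℤ Γ 2,
              ψ (S.inl (Multiplicative.ofAdd x)) = St.inl (Multiplicative.ofAdd (ε x))) ∧
            ψ.ker ≤ S.inl.range ∧ St.rightHom.comp ψ = S.rightHom) ∧
          (∀ ψ : E →* Γt, Function.Surjective ψ →
            (∀ x : trivialHomology ℤ Γ 2,
              ψ (S.inl (Multiplicative.ofAdd x)) = St.inl (Multiplicative.ofAdd (ε x))) →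
            ψ.ker ≤ S.inl.range →
            Function.Bijective (quasimorphismMap ψ)) ∧
          Module.finrank ℝ (QuasimorphismSpace Γt) = 1 ∧
          Module.finrank ℝ (QuasimorphismSpace E) = 1 ∧
          scl '' (commutator E : Set E) = scl '' (commutator Γt : Set Γt) := by
  obtain ⟨m, εL, hm, hrange, hε, x₁, hx₁⟩ := hρ.exists_epsilon
  let ε : trivialHomology ℤ Γ 2 ⟶ ModuleCat.of ℤ ℤ := ModuleCat.ofHom εL
  refine ⟨m, ε, hm, hrange, hε, exists_coefficient_class hε ⟨x₁, hx₁⟩, ?_⟩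
  intro φ hφ hφm E Γt _ _ S St ⟨hS, σ, c, hσ, hc⟩ ⟨hSt, σt, ct, hσt, hct⟩
  obtain ⟨K⟩ := exists_centralCoordinates S hS σ (fun x => (c.1 x : trivialHomology ℤ Γ 2)) hσ
  obtain ⟨Kt⟩ := exists_centralCoordinates St hSt σt (fun x => (ct.1 x : ModuleCat.of ℤ ℤ)) hσt
  have hc' : (groupCohomology.H2π (Rep.trivial ℤ Γ (trivialHomology ℤ Γ 2))).hom c = φ := hc
  have hct' : (groupCohomology.H2π (Rep.trivial ℤ Γ (ModuleCat.of ℤ ℤ))).hom ct =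
    eulerClass ρ := hct
  subst hc'
  -- evaluations of the two cocycles
  have hκ : ∀ a : trivialHomology ℤ Γ 2, ∃ z : groupHomology.cycles₂ (Rep.trivial ℤ Γ ℤ),
      Finsupp.linearCombination ℤ (fun x => (c.1 x : trivialHomology ℤ Γ 2)) z.1 = m • a := by
    intro a
    obtain ⟨z, rfl⟩ := groupHomology_H2π_surjective _ a
    exact ⟨z, (kronecker_H2π c z).symm.trans (hφm _)⟩
  have hκt : ∀ a : ModuleCat.of ℤ ℤ, ∃ z : groupHomology.cycles₂ (Rep.trivial ℤ Γ ℤ),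
      Finsupp.linearCombination ℤ (fun x => (ct.1 x : ModuleCat.of ℤ ℤ)) z.1 = m • a := by
    intro a
    have : (m • a : ModuleCat.of ℤ ℤ) ∈ Set.range (kronecker (eulerClass ρ)) := by
      rw [hrange]
      exact ⟨a, nsmul_eq_mul m (a : ℤ)⟩
    obtain ⟨y, hy⟩ := this
    obtain ⟨z, rfl⟩ := groupHomology_H2π_surjective _ y
    rw [← hct'] at hy
    exact ⟨z, (kronecker_H2π ct z).symm.trans hy⟩
  have hE := K.hom_eq_zero hρ.hom_eq_zero hm hκ
  have hEt := Kt.hom_eq_zero hρ.hom_eq_zero hm hκt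
  -- comparison of the cocycles
  have hφ' := (coefficientMap₂_H2π ε c).symm.trans hφ
  obtain ⟨b, hb⟩ := exists_coboundary_of_H2π_eq (hφ'.trans hct'.symm)
  obtain ⟨b₁, hb₁⟩ := exists_coboundary_of_H2π_eq (A := ModuleCat.of ℤ ℤ) (c := ct)
    (d := ⟨eulerCocycle ρ, (groupCohomology.mem_cocycles₂_iff _).2 (eulerCocycle_identity ρ)⟩) hct'
  obtain ⟨b₂, hb₂⟩ := exists_coboundary_of_H2π_eq (A := ModuleCat.of ℤ ℤ)
    (d := ⟨eulerCocycle ρ, (groupCohomology.mem_cocycles₂_iff _).2 (eulerCocycle_identity ρ)⟩) hφ'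
  -- Under these homomorphisms both extension cocycles become the Euler cocycle up to a coboundary.
  let χ : trivialHomology ℤ Γ 2 →+ ℝ := (Int.castAddHom ℝ).comp εL.toAddMonoidHom
  let χt : (ModuleCat.of ℤ ℤ) →+ ℝ := Int.castAddHom ℝ
  have hχ : χ ≠ 0 := fun h => by
    have h1 : ((εL x₁ : ℤ) : ℝ) = 0 := DFunLike.congr_fun h x₁
    rw [hx₁] at h1
    norm_num at h1
  have hχt : χt ≠ 0 := fun h => by
    have h1 : ((1 : ℤ) : ℝ) = 0 := DFunLike.congr_fun h (1 : ℤ)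
    norm_num at h1
  have hbt : ∀ g h, χt (ct.1 (g, h)) = eulerCocycle ρ (g, h) +
      (((b₁ h : ℤ) : ℝ) - ((b₁ (g * h) : ℤ) : ℝ) + ((b₁ g : ℤ) : ℝ)) := fun g h => by
    have h1 : (ct.1 (g, h) : ℤ) = eulerCocycle ρ (g, h) +
      ((b₁ h : ℤ) - (b₁ (g * h) : ℤ) + (b₁ g : ℤ)) := hb₁ g h
    change ((ct.1 (g, h) : ℤ) : ℝ) = _
    rw [h1]
    push_cast
    rfl
  have hbE : ∀ g h, χ (c.1 (g, h)) = eulerCocycle ρ (g, h) +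
      (((b₂ h : ℤ) : ℝ) - ((b₂ (g * h) : ℤ) : ℝ) + ((b₂ g : ℤ) : ℝ)) := fun g h => by
    have h1 : εL (c.1 (g, h)) = eulerCocycle ρ (g, h) +
      ((b₂ h : ℤ) - (b₂ (g * h) : ℤ) + (b₂ g : ℤ)) := hb₂ g h
    change ((εL (c.1 (g, h)) : ℤ) : ℝ) = _
    rw [h1]
    push_cast
    rfl
  have hQE : Module.finrank ℝ (QuasimorphismSpace E) = 1 :=
    finrank_quasimorphismSpace_eq_one hE
      ⟨K.coordQuasimorphism χ fun g => ((b₂ g : ℤ) : ℝ), 1, K.coordQuasimorphism_mul hbE⟩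
      (K.coordQuasimorphism_unbounded hχ fun g => ((b₂ g : ℤ) : ℝ)) fun f => by
        obtain ⟨D, hD⟩ := f.2
        exact K.exists_near_coordQuasimorphism hρ hbE hm hκ hD
  have hQt : Module.finrank ℝ (QuasimorphismSpace Γt) = 1 :=
    finrank_quasimorphismSpace_eq_one hEt
      ⟨Kt.coordQuasimorphism χt fun g => ((b₁ g : ℤ) : ℝ), 1, Kt.coordQuasimorphism_mul hbt⟩
      (Kt.coordQuasimorphism_unbounded hχt fun g => ((b₁ g : ℤ) : ℝ)) fun f => by
        obtain ⟨D, hD⟩ := f.2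
        exact Kt.exists_near_coordQuasimorphism hρ hbt hm hκt hD
  have hfin := finite_trivialHomology_two hρ.finitelyPresented
  have hεsurj : Function.Surjective εL := fun n => ⟨n • x₁, by
    rw [map_zsmul, hx₁, smul_eq_mul, mul_one]⟩
  obtain ⟨ψ, hψ, hψ'⟩ := K.exists_hom Kt hSt εL.toAddMonoidHom b hb
  have hψsurj : Function.Surjective ψ := surjective_of_covers hεsurj hψ hψ'
  have hψker : ψ.ker ≤ S.inl.range := ker_le_range_of_covers hψ'
  refine ⟨⟨?_, ?_⟩, ⟨ψ, hψsurj, hψ, hψker, hψ'⟩, ?_, hQt, hQE, ?_⟩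
  · exact Group.IsFinitelyPresented.of_central_extension S.inl S.rightHom S.rightHom_surjective
      S.range_inl_eq_ker_rightHom hS (isFinitelyPresented_multiplicative_of_finite _)
      S.inl_injective hρ.finitelyPresented
  · exact subsingleton_trivialHomology_two fun w hw =>
      CentralCoordinates.exists_real_coboundary hS K hm hφm hE hw
  · intro ψ hψ _ _
    have hinj := quasimorphismMap_injective hE ψ hψ
    have := Module.finite_of_finrank_eq_succ hQE
    have := Module.finite_of_finrank_eq_succ hQt
    exact ⟨hinj, (LinearMap.injective_iff_surjective_of_finrank_eq_finrank
      (hQt.trans hQE.symm)).1 hinj⟩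
  -- A kernel element `S.inl x` has `ε x = 0`, so the coordinate quasimorphism is constant on its
  -- powers, and hence every quasimorphism is bounded on them.
  · refine scl_image_commutator_eq ψ hψsurj (hψker.trans hS) ⟨7, fun h hh _ n _ => ?_⟩
    obtain ⟨x, rfl⟩ := hψker hh
    have hεx : εL (Multiplicative.toAdd x) = 0 := by
      have h1 := hψ (Multiplicative.toAdd x)
      rw [ofAdd_toAdd, MonoidHom.mem_ker.1 hh] at h1
      have h2 := St.inl_injective (h1.symm.trans (map_one _).symm)
      exact Multiplicative.ofAdd.injective h2
    refine exists_isCommutatorProduct_pow (fun χ => by rw [hE χ]; rfl) (fun f hf => ?_) n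
    obtain ⟨t, C, hC⟩ := K.exists_near_coordQuasimorphism hρ hbE hm hκ hf
    refine ⟨C + |t * (χ (K.coord 1) + ((b₂ 1 : ℤ) : ℝ))|, fun k => ?_⟩
    have h1 := hC (S.inl x ^ k)
    have h2 : K.coordQuasimorphism χ (fun g => ((b₂ g : ℤ) : ℝ)) (S.inl x ^ k) =
        χ (K.coord 1) + ((b₂ 1 : ℤ) : ℝ) := by
      have h3 : K.coord (S.inl x ^ k) = k • Multiplicative.toAdd x + K.coord 1 := by
        rw [← map_pow]
        exact K.coord_inl (k • Multiplicative.toAdd x)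
      have h4 : χ (Multiplicative.toAdd x) = 0 := by
        change ((εL (Multiplicative.toAdd x) : ℤ) : ℝ) = 0
        rw [hεx, Int.cast_zero]
      rw [CentralCoordinates.coordQuasimorphism, h3, map_add, map_nsmul, h4, smul_zero, zero_add,
        ← map_pow, CentralCoordinates.rightHom_inl]
    rw [h2] at h1
    have h5 := abs_sub_abs_le_abs_sub (f (S.inl x ^ k)) (t * (χ (K.coord 1) + ((b₂ 1 : ℤ) : ℝ)))
    linarith
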